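/- For a commutative ring $A$ let $W(A)=1+TA[[T]]$ be the ring of big Witt vectors: its addition is the multiplication of power series, and its multiplication is the functorial, biadditive, $T$-adically continuous one with $(1-aT)\odot(1-bT)=1-abT$. Let $W_{\mathrm{rat}}(A)\subset W(A)$ be the subring of all $f=P/Q$ with $P,Q\in A[T]$ and $P(0)=Q(0)=1$. Let $W_J(A)$ be the set of all $f=1+a_1T+a_2T^2+\dots\in W(A)$ whose Hankel matrix $(a_{i+j})_{i,j\ge 0}$ (with $a_0=1$) has finite rank, i.e. for which there is an $n$ such that all $(n+1)\times(n+1)$ minors of this matrix vanish; for Noetherian $A$ it is a subring of $W(A)$ containing $W_{\mathrm{rat}}(A)$. Let $\underline{\mathbb Z}(A)=\mathbb Z A/\mathbb Z(0)$ be the monoid ring of $(A,\cdot)$ modulo the ideal $\mathbb Z(0)$, and let $\omega:\underline{\mathbb Z}(A)\to W_{\mathrm{rat}}(A)$ be the ring homomorphism with $\omega((a))=1-aT$. On the category $\mathrm{NoethAffSch}$ of Noetherian affine schemes consider the presheaves of rings $\underline{\mathbb Z}(\mathcal O)$, $W_{\mathrm{rat}}(\mathcal O)$, $W_J(\mathcal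 O)$, $W(\mathcal O)$ obtained by applying these functors to $X\mapsto\Gamma(X,\mathcal O_X)$, with the maps $\underline{\mathbb Z}(\mathcal O)\xrightarrow{\omega}W_{\mathrm{rat}}(\mathcal O)\subset W_J(\mathcal O)\subset W(\mathcal O)$. For a pretopology on $\mathrm{NoethAffSch}$ let $F\mapsto F^\sharp$ denote sheafification for the topology it generates. The $f$-pretopology is the one whose coverings are the jointly surjective families of finite morphisms. 1) For any pretopology on $\mathrm{NoethAffSch}$ for which all finite jointly surjective families of closed immersions are coverings, the map $W_{\mathrm{rat}}(\mathcal O)^\sharp\to W_J(\mathcal O)^\sharp$ is an isomorphism of sheaves of rings. 2) For any pretopology on $\mathrm{NoethAffSch}$ which is finer than the $f$-pretopology (i.e. generates a finer topology), the maps $$\underline{\mathbb Z}(\mathcal O)^\sharp\to W_{\mathrm{rat}}(\mathcal O)^\sharp\to W_J(\mathcal O)^\sharp$$ are isomorphisms of sheaves of rings, and the canonical maps from these three sheaves to $W(\mathcal O)^\sharp$ are injective, so that they are isomorphisms of subring sheaves of $W(\mathcal O)^\sharp$. -/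

import Mathlib

universe u v w

open CategoryTheory AlgebraicGeometry
open scoped Kronecker

section Ghost
open PowerSeries

/-- `G` is the ghost series `- T f' / f` of `f`. -/
def IsGhostSeries {A : Type*} [CommRing A] (f G : PowerSeries A) : Prop :=
  -(PowerSeries.X * PowerSeries.derivative A f) = G * f

theorem IsGhostSeries.exists {A : Type*} [CommRing A] {f : PowerSeries A}
    (hf : constantCoeff f = 1) : ∃ G, IsGhostSeries f G := by
  refine ⟨-(PowerSeries.X * PowerSeries.derivative A f) * invOfUnit f 1, ?_⟩
  have h := mul_invOfUnit f 1 (by simpa using hf)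
  unfold IsGhostSeries
  linear_combination (-(-(PowerSeries.X * PowerSeries.derivative A f))) * h

theorem IsGhostSeries.coeff_zero {A : Type*} [CommRing A] {f G : PowerSeries A}
    (hf : constantCoeff f = 1) (h : IsGhostSeries f G) : coeff 0 G = 0 := by
  have := congrArg constantCoeff h
  simpa [hf] using this.symm

theorem IsGhostSeries.coeff_eq_of_agree {A : Type*} [CommRing A] {f g F G : PowerSeries A}
    (hf : constantCoeff f = 1) (hF : IsGhostSeries f F) (hG : IsGhostSeries g G) {n : ℕ}
    (h : ∀ k ≤ n, coeff k f = coeff k g) : ∀ k ≤ n, coeff k F = coeff k G := by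
  have h1 : PowerSeries.X ^ (n + 1) ∣ f - g := X_pow_dvd_iff.2 fun m hm => by
    simp [h m (by omega)]
  have h2 : PowerSeries.X ^ (n + 1) ∣
      PowerSeries.X * PowerSeries.derivative A (f - g) := by
    refine X_pow_dvd_iff.2 fun m hm => ?_
    rcases m with _ | m
    · simp
    · rw [coeff_succ_X_mul, coeff_derivative, map_sub, h _ (by omega), sub_self, zero_mul]
  have h3 : (F - G) * f = -(PowerSeries.X * PowerSeries.derivative A (f - g)) - G * (f - g) := by
    unfold IsGhostSeries at hF hG
    rw [map_sub]
    linear_combination hG - hF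
  have h4 : PowerSeries.X ^ (n + 1) ∣ F - G := by
    have h5 : PowerSeries.X ^ (n + 1) ∣ (F - G) * f := by
      rw [h3]; exact dvd_sub ((dvd_neg).2 h2) (h1.mul_left _)
    have h6 := h5.mul_right (invOfUnit f 1)
    rwa [mul_assoc, mul_invOfUnit f 1 (by simpa using hf), mul_one] at h6
  intro k hk
  have := X_pow_dvd_iff.1 h4 k (by omega)
  rwa [map_sub, sub_eq_zero] at this

theorem IsGhostSeries.agree_of_coeff_eq {A : Type*} [CommRing A] [IsDomain A] [CharZero A]
    {f g F G : PowerSeries A} (hf : constantCoeff f = 1) (hg : constantCoeff g = 1)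
    (hF : IsGhostSeries f F) (hG : IsGhostSeries g G) {n : ℕ}
    (h : ∀ k ≤ n, coeff k F = coeff k G) : ∀ k ≤ n, coeff k f = coeff k g := by
  have h3 : -(PowerSeries.X * PowerSeries.derivative A (f - g)) = (F - G) * f + G * (f - g) := by
    unfold IsGhostSeries at hF hG
    rw [map_sub]
    linear_combination hF - hG
  have h0 : PowerSeries.X ^ (n + 1) ∣ F - G := X_pow_dvd_iff.2 fun m hm => by
    simp [h m (by omega)]
  intro k
  induction k using Nat.strong_induction_on with
  | _ k ih =>
    intro hk
    rcases k with _ | k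
    · simp [hf, hg]
    · have e := congrArg (coeff (k + 1)) h3
      rw [map_neg, coeff_succ_X_mul, coeff_derivative, map_add,
        X_pow_dvd_iff.1 (h0.mul_right f) (k + 1) (by omega), zero_add, coeff_mul,
        Finset.sum_eq_zero] at e
      · have hne : ((k : A) + 1) ≠ 0 := by exact_mod_cast Nat.succ_ne_zero k
        have := (mul_eq_zero.1 (neg_eq_zero.1 e)).resolve_right hne
        rwa [map_sub, sub_eq_zero] at this
      · rintro ⟨i, j⟩ hij
        replace hij := Finset.HasAntidiagonal.mem_antidiagonal.1 hij
        rcases i with _ | i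
        · rw [hG.coeff_zero hg, zero_mul]
        · rw [map_sub, ih j (by simp at hij; omega) (by simp at hij; omega), sub_self, mul_zero]

theorem IsGhostSeries.unique {A : Type*} [CommRing A] [IsDomain A] [CharZero A]
    {f g F : PowerSeries A} (hf : constantCoeff f = 1) (hg : constantCoeff g = 1)
    (hF : IsGhostSeries f F) (hG : IsGhostSeries g F) : f = g :=
  PowerSeries.ext fun n => hF.agree_of_coeff_eq hf hg hG (fun _ _ => rfl) n le_rfl

theorem IsGhostSeries.mul {A : Type*} [CommRing A] {f g F G : PowerSeries A}
    (hF : IsGhostSeries f F) (hG : IsGhostSeries g G) : IsGhostSeries (f * g) (F + G) := by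
  unfold IsGhostSeries at *
  rw [Derivation.leibniz, smul_eq_mul, smul_eq_mul]
  linear_combination g * hF + f * hG

theorem derivative_det {A m : Type*} [CommRing A] [Fintype m] [DecidableEq m]
    (N : Matrix m m (Polynomial A)) :
    Polynomial.derivative N.det =
      (N.adjugate * N.map (fun p => Polynomial.derivative p)).trace := by
  have key : Polynomial.derivative N.det =
      ∑ i, (N.updateRow i (fun j => Polynomial.derivative (N i j))).det := by
    simp only [← Matrix.det_transpose N, ← Matrix.det_transpose (N.updateRow _ _)]
    simp only [Matrix.det_apply, map_sum, Matrix.transpose_apply]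
    rw [Finset.sum_comm]
    refine Finset.sum_congr rfl fun σ _ => ?_
    rw [← Finset.smul_sum]
    simp only [Units.smul_def, map_zsmul]
    congr 1
    rw [Polynomial.derivative_prod_finset]
    refine Finset.sum_congr rfl fun i _ => ?_
    rw [← Finset.mul_prod_erase Finset.univ _ (Finset.mem_univ i), mul_comm]
    congr 1
    · simp
    · refine Finset.prod_congr rfl fun j hj => ?_
      rw [Matrix.updateRow_ne (Finset.ne_of_mem_erase hj)]
  rw [key, Matrix.trace_mul_comm, Matrix.trace]
  refine Finset.sum_congr rfl fun i _ => ?_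
  rw [← Matrix.cramer_transpose_apply, Matrix.cramer_eq_adjugate_mulVec, Matrix.mulVec,
    Matrix.diag_apply, Matrix.mul_apply, dotProduct]
  refine Finset.sum_congr rfl fun j _ => ?_
  rw [← Matrix.adjugate_transpose, Matrix.transpose_apply, Matrix.map_apply, mul_comm]

theorem isGhostSeries_charpolyRev {A m : Type*} [CommRing A] [Fintype m] [DecidableEq m]
    (M : Matrix m m A) :
    IsGhostSeries (M.charpolyRev : PowerSeries A)
      (PowerSeries.mk fun k => if k = 0 then 0 else (M ^ k).trace) := by
  let c : Polynomial A →+* PowerSeries A := Polynomial.coeToPowerSeries.ringHom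
  let N : Matrix m m (Polynomial A) := 1 - (Polynomial.X : Polynomial A) • M.map Polynomial.C
  have hdN : N.map (fun p => Polynomial.derivative p) = -(M.map Polynomial.C) := by
    ext i j : 1
    by_cases h : i = j <;> simp [N, h]
  have hd : Polynomial.derivative M.charpolyRev = -(N.adjugate * M.map Polynomial.C).trace := by
    rw [Matrix.charpolyRev, derivative_det]
    change (N.adjugate * N.map _).trace = _
    rw [hdN, mul_neg, Matrix.trace_neg]
  let S : Matrix m m (PowerSeries A) := Matrix.of fun i j => PowerSeries.mk fun k => (M ^ k) i j
  have hS : N.map c * S = 1 := by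
    ext i j k
    have hN : N.map c = 1 - (PowerSeries.X : PowerSeries A) • M.map (PowerSeries.C (R := A)) := by
      ext i j : 1
      by_cases h : i = j <;> simp [N, c, h, PowerSeries.X_mul]
    rw [hN, sub_mul, one_mul, Matrix.smul_mul, Matrix.sub_apply, Matrix.smul_apply, map_sub,
      smul_eq_mul, Matrix.mul_apply]
    rcases k with _ | k
    · by_cases h : i = j <;> simp [S, h, Matrix.one_apply]
    · rw [coeff_succ_X_mul, map_sum]
      simp only [S, Matrix.of_apply, coeff_mk, Matrix.map_apply, coeff_C_mul]
      rw [pow_succ', Matrix.mul_apply, sub_self]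
      by_cases h : i = j <;> simp [h, Matrix.one_apply, coeff_one]
  have hadj : N.adjugate.map c = c M.charpolyRev • S := by
    have h1 : (N.adjugate * N).map c = (N.det • (1 : Matrix m m (Polynomial A))).map c := by
      rw [Matrix.adjugate_mul]
    rw [Matrix.map_mul] at h1
    have h2 := congrArg (· * S) h1
    simp only [mul_assoc, hS, mul_one] at h2
    rw [h2]
    have : (N.det • (1 : Matrix m m (Polynomial A))).map c
        = c M.charpolyRev • (1 : Matrix m m (PowerSeries A)) := by
      ext i j : 1
      by_cases h : i = j <;> simp [h, N, Matrix.charpolyRev]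
    rw [this, Matrix.smul_mul, one_mul]
  have hd' : PowerSeries.derivative A (M.charpolyRev : PowerSeries A) =
      -(c M.charpolyRev * (S * M.map (PowerSeries.C (R := A))).trace) := by
    have : PowerSeries.derivative A (M.charpolyRev : PowerSeries A)
        = c (Polynomial.derivative M.charpolyRev) := by
      exact PowerSeries.derivative_coe _
    have ht : c M.charpolyRev * (S * M.map (PowerSeries.C (R := A))).trace =
        (c M.charpolyRev • S * M.map (PowerSeries.C (R := A))).trace := by
      rw [Matrix.smul_mul, Matrix.trace_smul, smul_eq_mul]
    rw [this, hd, map_neg, ht, ← hadj]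
    congr 1
    rw [AddMonoidHom.map_trace, Matrix.map_mul]
    congr 2
    ext i j : 1
    simp [c]
  unfold IsGhostSeries
  rw [hd']
  change _ = _ * c M.charpolyRev
  have : (PowerSeries.mk fun k => if k = 0 then 0 else (M ^ k).trace)
      = PowerSeries.X * (S * M.map (PowerSeries.C (R := A))).trace := by
    ext k
    rcases k with _ | k
    · simp
    · rw [coeff_succ_X_mul]
      simp only [coeff_mk, Nat.succ_ne_zero, if_false, Matrix.trace, map_sum, Matrix.diag_apply,
        pow_succ, Matrix.mul_apply, S, Matrix.of_apply, Matrix.map_apply, coeff_mul_C]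
  rw [this]; ring
end Ghost

theorem charpolyRev_map {A B m : Type*} [CommRing A] [CommRing B] [Fintype m] [DecidableEq m]
    (φ : A →+* B) (M : Matrix m m A) : (M.map φ).charpolyRev = M.charpolyRev.map φ := by
  rw [Matrix.charpolyRev, Matrix.charpolyRev, ← Polynomial.coe_mapRingHom, RingHom.map_det]
  congr 1
  ext i j : 1
  by_cases h : i = j <;> simp [h]

/-- The companion matrix with `det (1 - T M) = 1 + a₁ T + ⋯ + aₙ Tⁿ`. -/
noncomputable def bigWittCompanion {A : Type*} [CommRing A] (n : ℕ) (f : PowerSeries A) :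
    Matrix (Fin n) (Fin n) A :=
  Matrix.of fun i j => if (i : ℕ) = 0 then -PowerSeries.coeff (j + 1) f
    else if (i : ℕ) = j + 1 then 1 else 0

theorem bigWittCompanion_map {A B : Type*} [CommRing A] [CommRing B] (φ : A →+* B) (n : ℕ)
    (f : PowerSeries A) :
    bigWittCompanion n (PowerSeries.map φ f) = (bigWittCompanion n f).map φ := by
  ext i j
  simp only [bigWittCompanion, Matrix.of_apply, Matrix.map_apply]
  split_ifs <;> simp

theorem charpolyRev_bigWittCompanion {A : Type*} [CommRing A] (n : ℕ) (f : PowerSeries A)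
    (hf : PowerSeries.constantCoeff f = 1) :
    (bigWittCompanion n f).charpolyRev = PowerSeries.trunc (n + 1) f := by
  rcases n with _ | n
  · ext k
    rcases k with _ | k
    · simp [Matrix.charpolyRev, hf]
    · simp [Matrix.charpolyRev, Polynomial.coeff_one]
  let M := bigWittCompanion (n + 1) f
  let N : Matrix (Fin (n + 1)) (Fin (n + 1)) (Polynomial A) :=
    1 - (Polynomial.X : Polynomial A) • M.map Polynomial.C
  let V : Matrix (Fin (n + 1)) (Fin (n + 1)) (Polynomial A) :=
    Matrix.of fun i j => if j ≤ i then Polynomial.X ^ ((i : ℕ) - j) else 0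
  have hV : V.det = 1 := by
    rw [Matrix.det_of_isLowerTriangular]
    · simp [V]
    · intro i j hij
      simp only [OrderDual.toDual_lt_toDual] at hij
      simp [V, hij]
  have hrow : ∀ i j, i ≠ 0 → (N * V) i j = if i = j then 1 else 0 := by
    intro i j hi
    obtain ⟨i, rfl⟩ := Fin.exists_succ_eq.2 hi
    have : ∀ k, N i.succ k = (if i.succ = k then 1 else 0) -
        (if i.castSucc = k then Polynomial.X else 0) := by
      intro k
      simp only [N, M, bigWittCompanion, Matrix.sub_apply, Matrix.one_apply, Matrix.smul_apply,
        Matrix.map_apply, Matrix.of_apply, smul_eq_mul, Fin.val_succ, Nat.succ_ne_zero, if_false]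
      congr 1
      have : ((i : ℕ) + 1 = k + 1) ↔ i.castSucc = k := by
        rw [Fin.ext_iff]; simp
      simp only [this]
      split_ifs <;> simp
    rw [Matrix.mul_apply]
    simp only [this, sub_mul, Finset.sum_sub_distrib, ite_mul, one_mul, zero_mul,
      Finset.sum_ite_eq, Finset.mem_univ, if_true]
    simp only [V, Matrix.of_apply]
    rcases lt_trichotomy j i.succ with h | h | h
    · have h1 : j ≤ i.castSucc := by
        rw [Fin.lt_def] at h; rw [Fin.le_def]; simp at h ⊢; omega
      rw [if_pos h.le, if_pos h1, if_neg h.ne', ← pow_succ']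
      have : (i.succ : ℕ) - j = (i.castSucc : ℕ) - j + 1 := by
        rw [Fin.le_def] at h1; simp at h1 ⊢; omega
      rw [this, sub_self]
    · have h1 : ¬ j ≤ i.castSucc := by
        rw [h, Fin.le_def]; simp
      rw [if_pos h.le, if_neg h1, if_pos h.symm, h]; simp
    · have h1 : ¬ j ≤ i.castSucc := by
        rw [Fin.lt_def] at h; rw [Fin.le_def]; simp at h ⊢; omega
      rw [if_neg h.not_ge, if_neg h1, if_neg h.ne]; simp
  have h0 : (N * V) 0 0 = PowerSeries.trunc (n + 1 + 1) f := by
    rw [Matrix.mul_apply]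
    have : ∀ k, N 0 k * V k 0 = (if k = 0 then 1 else 0) +
        Polynomial.C (PowerSeries.coeff (k + 1) f) * Polynomial.X ^ ((k : ℕ) + 1) := by
      intro k
      simp only [N, M, V, bigWittCompanion, Matrix.sub_apply, Matrix.one_apply, Matrix.smul_apply,
        Matrix.map_apply, Matrix.of_apply, smul_eq_mul, Fin.val_zero, if_true, Fin.zero_le,
        Nat.sub_zero]
      by_cases h : k = 0
      · subst h; simp
      · rw [if_neg h, if_neg (Ne.symm h)]; simp; ring
    simp only [this, Finset.sum_add_distrib, Finset.sum_ite_eq', Finset.mem_univ, if_true]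
    rw [Fin.sum_univ_eq_sum_range
      (fun k => Polynomial.C (PowerSeries.coeff (k + 1) f) * Polynomial.X ^ (k + 1)) (n + 1)]
    ext k
    rw [PowerSeries.coeff_trunc, Polynomial.coeff_add, Polynomial.finsetSum_coeff]
    simp only [Polynomial.coeff_C_mul, Polynomial.coeff_X_pow, Polynomial.coeff_one]
    rcases k with _ | k
    · simp [hf]
    · simp
  have hdet : (N * V).det = PowerSeries.trunc (n + 1 + 1) f := by
    rw [Matrix.det_of_isUpperTriangular, Fin.prod_univ_succ, h0, Finset.prod_eq_one, mul_one]
    · intro i _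
      rw [hrow _ _ (Fin.succ_ne_zero i), if_pos rfl]
    · intro i j hij
      rw [hrow i j (Fin.pos_iff_ne_zero.1 (lt_of_le_of_lt (Fin.zero_le _) hij)),
        if_neg (fun h => absurd hij (by simp [h]))]
  rwa [Matrix.det_mul, hV, mul_one] at hdet

/-- Coefficients of the Witt product of two power series with constant coefficient one. -/
noncomputable def bigWittMulSeries {A : Type*} [CommRing A] (f g : PowerSeries A) :
    PowerSeries A :=
  PowerSeries.mk fun n =>
    (bigWittCompanion n f ⊗ₖ bigWittCompanion n g).charpolyRev.coeff n

theorem bigWittMulSeries_map {A B : Type*} [CommRing A] [CommRing B] (φ : A →+* B)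
    (f g : PowerSeries A) :
    bigWittMulSeries (PowerSeries.map φ f) (PowerSeries.map φ g) =
      PowerSeries.map φ (bigWittMulSeries f g) := by
  ext n
  have : (bigWittCompanion n f).map φ ⊗ₖ (bigWittCompanion n g).map φ =
      (bigWittCompanion n f ⊗ₖ bigWittCompanion n g).map φ := by
    ext i j; simp [Matrix.kroneckerMap_apply]
  simp only [bigWittMulSeries, PowerSeries.coeff_mk, PowerSeries.coeff_map, bigWittCompanion_map,
    this, charpolyRev_map, Polynomial.coeff_map]

theorem constantCoeff_charpolyRev {A m : Type*} [CommRing A] [Fintype m] [DecidableEq m]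
    (M : Matrix m m A) :
    PowerSeries.constantCoeff (M.charpolyRev : PowerSeries A) = 1 := by
  rw [Polynomial.constantCoeff_coe, Polynomial.coeff_zero_eq_eval_zero]
  exact M.eval_charpolyRev

theorem constantCoeff_bigWittMulSeries {A : Type*} [CommRing A] (f g : PowerSeries A) :
    PowerSeries.constantCoeff (bigWittMulSeries f g) = 1 := by
  simp [bigWittMulSeries, ← PowerSeries.coeff_zero_eq_constantCoeff_apply, Matrix.charpolyRev]

open PowerSeries in
theorem IsGhostSeries.bigWittMulSeries {A : Type*} [CommRing A] [IsDomain A] [CharZero A]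
    {f g F G : PowerSeries A} (hf : constantCoeff f = 1) (hg : constantCoeff g = 1)
    (hF : IsGhostSeries f F) (hG : IsGhostSeries g G) :
    IsGhostSeries (bigWittMulSeries f g) (PowerSeries.mk fun k => coeff k F * coeff k G) := by
  let H : PowerSeries A := PowerSeries.mk fun k => coeff k F * coeff k G
  have htr : ∀ {e E : PowerSeries A}, constantCoeff e = 1 → IsGhostSeries e E → ∀ n k, k ≤ n →
      coeff k E = if k = 0 then 0 else (bigWittCompanion n e ^ k).trace := by
    intro e E he hE n k hk
    have := hE.coeff_eq_of_agree he (isGhostSeries_charpolyRev (bigWittCompanion n e)) (n := n)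
      (fun k hk => by
        rw [charpolyRev_bigWittCompanion n e he, Polynomial.coeff_coe, coeff_trunc,
          if_pos (by omega)]) k hk
    simpa using this
  have hT : ∀ n k, k ≤ n → (if k = 0 then 0 else
      ((bigWittCompanion n f ⊗ₖ bigWittCompanion n g) ^ k).trace) = coeff k H := by
    intro n k hk
    have hp : (bigWittCompanion n f ⊗ₖ bigWittCompanion n g) ^ k =
        (bigWittCompanion n f ^ k) ⊗ₖ (bigWittCompanion n g ^ k) := by
      induction k with
      | zero => simp
      | succ k ih => rw [pow_succ, ih (by omega), pow_succ, pow_succ, Matrix.mul_kronecker_mul]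
    simp only [H, coeff_mk]
    rw [htr hf hF n k hk, htr hg hG n k hk, hp, Matrix.trace_kronecker]
    split_ifs <;> simp
  have hagree : ∀ n, ∀ m ≤ n, coeff m (_root_.bigWittMulSeries f g) =
      coeff m ((bigWittCompanion n f ⊗ₖ bigWittCompanion n g).charpolyRev : PowerSeries A) := by
    intro n m hm
    rw [_root_.bigWittMulSeries, coeff_mk, ← Polynomial.coeff_coe]
    refine (isGhostSeries_charpolyRev _).agree_of_coeff_eq (constantCoeff_charpolyRev _)
      (constantCoeff_charpolyRev _) (isGhostSeries_charpolyRev _) (n := m) (fun k hk => ?_) m le_rfl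
    rw [coeff_mk, coeff_mk, hT m k hk, hT n k (hk.trans hm)]
  obtain ⟨H', hH'⟩ := IsGhostSeries.exists (constantCoeff_bigWittMulSeries f g)
  have : H' = H := by
    ext n
    have := hH'.coeff_eq_of_agree (constantCoeff_bigWittMulSeries f g)
      (isGhostSeries_charpolyRev _) (hagree n) n le_rfl
    rw [this, coeff_mk, hT n n le_rfl]
  rwa [this] at hH'

/-- The big Witt vectors `W(A) = 1 + T A⟦T⟧`. -/
@[ext]
structure BigWitt (A : Type*) [CommRing A] where
  /-- The underlying power series. -/
  series : PowerSeries A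
  constantCoeff_series : PowerSeries.constantCoeff series = 1

namespace BigWitt

section Basic

variable {A B C : Type*} [CommRing A] [CommRing B] [CommRing C]

theorem series_injective : Function.Injective (BigWitt.series (A := A)) :=
  fun _ _ h => BigWitt.ext h

/-- Witt addition is the multiplication of power series. -/
noncomputable instance : Add (BigWitt A) :=
  ⟨fun f g => ⟨f.series * g.series, by
    rw [map_mul, f.constantCoeff_series, g.constantCoeff_series, one_mul]⟩⟩

noncomputable instance : Zero (BigWitt A) := ⟨⟨1, map_one _⟩⟩

noncomputable instance : Neg (BigWitt A) :=
  ⟨fun f => ⟨PowerSeries.invOfUnit f.series 1, by simp⟩⟩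

/-- Witt multiplication is the functorial, biadditive, `T`-adically continuous operation with
`det (1 - T M) * det (1 - T N) = det (1 - T (M ⊗ N))` for square matrices `M` and `N`;
in particular `(1 - a T) * (1 - b T) = 1 - a b T`. -/
noncomputable instance : Mul (BigWitt A) :=
  ⟨fun f g => ⟨bigWittMulSeries f.series g.series, constantCoeff_bigWittMulSeries _ _⟩⟩

/-- The multiplicative representative `[a] = 1 - a T`. -/
noncomputable def teichmuller (a : A) : BigWitt A :=
  ⟨1 - PowerSeries.C a * PowerSeries.X, by simp⟩

noncomputable instance : One (BigWitt A) := ⟨teichmuller 1⟩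

theorem series_add (f g : BigWitt A) : (f + g).series = f.series * g.series := rfl
theorem series_zero : (0 : BigWitt A).series = 1 := rfl
theorem series_neg (f : BigWitt A) : (-f).series = PowerSeries.invOfUnit f.series 1 := rfl
theorem series_mul (f g : BigWitt A) : (f * g).series = bigWittMulSeries f.series g.series := rfl
theorem one_def : (1 : BigWitt A) = teichmuller 1 := rfl

theorem series_neg_mul (f : BigWitt A) : (-f).series * f.series = 1 := by
  rw [series_neg, mul_comm]
  exact PowerSeries.mul_invOfUnit _ _ (by simpa using f.constantCoeff_series)

/-- The map on big Witt vectors induced by a ring homomorphism, as a function. -/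
noncomputable def mapFun (φ : A →+* B) (f : BigWitt A) : BigWitt B :=
  ⟨PowerSeries.map φ f.series, by
    rw [← PowerSeries.coeff_zero_eq_constantCoeff_apply, PowerSeries.coeff_map,
      PowerSeries.coeff_zero_eq_constantCoeff_apply, f.constantCoeff_series, map_one]⟩

theorem mapFun_add (φ : A →+* B) (f g : BigWitt A) :
    mapFun φ (f + g) = mapFun φ f + mapFun φ g :=
  BigWitt.ext (map_mul (PowerSeries.map φ) _ _)

theorem mapFun_zero (φ : A →+* B) : mapFun φ 0 = 0 := BigWitt.ext (map_one (PowerSeries.map φ))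

theorem mapFun_mul (φ : A →+* B) (f g : BigWitt A) :
    mapFun φ (f * g) = mapFun φ f * mapFun φ g :=
  BigWitt.ext (bigWittMulSeries_map φ _ _).symm

theorem mapFun_teichmuller (φ : A →+* B) (a : A) :
    mapFun φ (teichmuller a) = teichmuller (φ a) :=
  BigWitt.ext (by simp [mapFun, teichmuller])

theorem exists_lift (f : BigWitt A) : ∃ g : BigWitt (MvPolynomial A ℤ),
    mapFun (MvPolynomial.aeval (R := ℤ) (id : A → A)).toRingHom g = f := by
  refine ⟨⟨PowerSeries.mk fun n => if n = 0 then 1 else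
    MvPolynomial.X (PowerSeries.coeff n f.series), by
      simp [← PowerSeries.coeff_zero_eq_constantCoeff_apply]⟩, ?_⟩
  ext n
  simp only [mapFun, PowerSeries.coeff_map, PowerSeries.coeff_mk]
  split_ifs with h
  · simp [h, f.constantCoeff_series]
  · simp

theorem eq_of_ghost [IsDomain A] [CharZero A] {f g : BigWitt A} {F G : PowerSeries A}
    (hf : IsGhostSeries f.series F) (hg : IsGhostSeries g.series G)
    (h : ∀ k, PowerSeries.coeff k F = PowerSeries.coeff k G) : f = g := by
  obtain rfl : F = G := PowerSeries.ext h
  exact BigWitt.ext (hf.unique f.constantCoeff_series g.constantCoeff_series hg)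

theorem exists_ghost (f : BigWitt A) : ∃ F, IsGhostSeries f.series F :=
  IsGhostSeries.exists f.constantCoeff_series

theorem ghost_mul [IsDomain A] [CharZero A] {f g : BigWitt A} {F G : PowerSeries A}
    (hf : IsGhostSeries f.series F) (hg : IsGhostSeries g.series G) :
    IsGhostSeries (f * g).series
      (PowerSeries.mk fun k => PowerSeries.coeff k F * PowerSeries.coeff k G) :=
  hf.bigWittMulSeries f.constantCoeff_series g.constantCoeff_series hg

theorem ghost_teichmuller (a : A) : IsGhostSeries (teichmuller a).series
    (PowerSeries.mk fun k => if k = 0 then 0 else a ^ k) := by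
  have h := isGhostSeries_charpolyRev (Matrix.of fun _ _ : Unit => a)
  have hp : ∀ k, (Matrix.of fun _ _ : Unit => a) ^ k = Matrix.of fun _ _ : Unit => a ^ k := by
    intro k
    induction k with
    | zero => ext; simp
    | succ k ih => ext; simp [pow_succ, ih, Matrix.mul_apply]
  have hs : ((Matrix.of fun _ _ : Unit => a).charpolyRev : PowerSeries A) =
      (teichmuller a).series := by
    simp [Matrix.charpolyRev, teichmuller]
  rw [hs] at h
  simpa [hp, Matrix.trace] using h

protected theorem mul_comm (f g : BigWitt A) : f * g = g * f := by
  obtain ⟨f, rfl⟩ := exists_lift f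
  obtain ⟨g, rfl⟩ := exists_lift g
  rw [← mapFun_mul, ← mapFun_mul]
  refine congrArg (mapFun _) ?_
  obtain ⟨F, hF⟩ := exists_ghost f
  obtain ⟨G, hG⟩ := exists_ghost g
  refine eq_of_ghost (ghost_mul hF hG) (ghost_mul hG hF) fun k => ?_
  simp only [PowerSeries.coeff_mk, mul_comm]

protected theorem mul_assoc (f g h : BigWitt A) : f * g * h = f * (g * h) := by
  obtain ⟨f, rfl⟩ := exists_lift f
  obtain ⟨g, rfl⟩ := exists_lift g
  obtain ⟨h, rfl⟩ := exists_lift h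
  simp only [← mapFun_mul]
  refine congrArg (mapFun _) ?_
  obtain ⟨F, hF⟩ := exists_ghost f
  obtain ⟨G, hG⟩ := exists_ghost g
  obtain ⟨H, hH⟩ := exists_ghost h
  refine eq_of_ghost (ghost_mul (ghost_mul hF hG) hH) (ghost_mul hF (ghost_mul hG hH))
    fun k => ?_
  simp only [PowerSeries.coeff_mk, mul_assoc]

protected theorem mul_add (f g h : BigWitt A) : f * (g + h) = f * g + f * h := by
  obtain ⟨f, rfl⟩ := exists_lift f
  obtain ⟨g, rfl⟩ := exists_lift g
  obtain ⟨h, rfl⟩ := exists_lift h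
  simp only [← mapFun_mul, ← mapFun_add]
  refine congrArg (mapFun _) ?_
  obtain ⟨F, hF⟩ := exists_ghost f
  obtain ⟨G, hG⟩ := exists_ghost g
  obtain ⟨H, hH⟩ := exists_ghost h
  have hGH : IsGhostSeries (g + h).series (G + H) := hG.mul hH
  have h2 : IsGhostSeries (f * g + f * h).series _ := (ghost_mul hF hG).mul (ghost_mul hF hH)
  refine eq_of_ghost (ghost_mul hF hGH) h2 fun k => ?_
  simp only [PowerSeries.coeff_mk, map_add, mul_add]

protected theorem one_mul (f : BigWitt A) : 1 * f = f := by
  obtain ⟨f, rfl⟩ := exists_lift f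
  rw [one_def, ← map_one (MvPolynomial.aeval (R := ℤ) (id : A → A)).toRingHom,
    ← mapFun_teichmuller, ← mapFun_mul]
  refine congrArg (mapFun _) ?_
  obtain ⟨F, hF⟩ := exists_ghost f
  refine eq_of_ghost (ghost_mul (ghost_teichmuller 1) hF) hF fun k => ?_
  rcases k with _ | k
  · simpa using (hF.coeff_zero f.constantCoeff_series).symm
  · simp

theorem teichmuller_mul (a b : A) : teichmuller (a * b) = teichmuller a * teichmuller b := by
  let φ := (MvPolynomial.aeval (R := ℤ) (id : A → A)).toRingHom
  have h : teichmuller (MvPolynomial.X a * MvPolynomial.X b : MvPolynomial A ℤ) =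
      teichmuller (MvPolynomial.X a) * teichmuller (MvPolynomial.X b) := by
    refine eq_of_ghost (ghost_teichmuller _)
      (ghost_mul (ghost_teichmuller _) (ghost_teichmuller _)) fun k => ?_
    simp only [PowerSeries.coeff_mk, mul_pow]
    split_ifs <;> simp
  have h2 := congrArg (mapFun φ) h
  simpa [mapFun_mul, mapFun_teichmuller, φ] using h2

theorem teichmuller_zero : teichmuller (0 : A) = 0 := BigWitt.ext (by simp [teichmuller, series_zero])

noncomputable instance : CommRing (BigWitt A) where
  add_assoc f g h := BigWitt.ext (mul_assoc _ _ _)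
  zero_add f := BigWitt.ext (one_mul _)
  add_zero f := BigWitt.ext (mul_one _)
  add_comm f g := BigWitt.ext (mul_comm _ _)
  nsmul := nsmulRec
  zsmul := zsmulRec
  neg_add_cancel f := BigWitt.ext (series_neg_mul f)
  mul_assoc := BigWitt.mul_assoc
  mul_comm := BigWitt.mul_comm
  one_mul := BigWitt.one_mul
  mul_one f := (BigWitt.mul_comm _ _).trans (BigWitt.one_mul f)
  left_distrib := BigWitt.mul_add
  right_distrib f g h := by
    rw [BigWitt.mul_comm, BigWitt.mul_add, BigWitt.mul_comm h f, BigWitt.mul_comm h g]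
  zero_mul f := by
    have h : f * (0 + 0) = f * 0 + f * 0 := BigWitt.mul_add f 0 0
    have h0 : (0 + 0 : BigWitt A) = 0 := BigWitt.ext (one_mul _)
    rw [h0] at h
    have h1 := congrArg BigWitt.series h
    rw [series_add] at h1
    have h2 := congrArg ((-(f * 0)).series * ·) h1
    simp only [← mul_assoc, series_neg_mul, one_mul] at h2
    rw [BigWitt.mul_comm]
    exact BigWitt.ext h2.symm
  mul_zero f := by
    have h : f * (0 + 0) = f * 0 + f * 0 := BigWitt.mul_add f 0 0
    have h0 : (0 + 0 : BigWitt A) = 0 := BigWitt.ext (one_mul _)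
    rw [h0] at h
    have h1 := congrArg BigWitt.series h
    rw [series_add] at h1
    have h2 := congrArg ((-(f * 0)).series * ·) h1
    simp only [← mul_assoc, series_neg_mul, one_mul] at h2
    exact BigWitt.ext h2.symm

/-- The ring homomorphism `W(A) → W(B)` which applies `φ` to the coefficients. -/
noncomputable def map (φ : A →+* B) : BigWitt A →+* BigWitt B where
  toFun := mapFun φ
  map_one' := by rw [one_def, mapFun_teichmuller, map_one, one_def]
  map_mul' := mapFun_mul φ
  map_zero' := mapFun_zero φ
  map_add' := mapFun_add φ

theorem series_map (φ : A →+* B) (f : BigWitt A) :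
    (map φ f).series = PowerSeries.map φ f.series := rfl

theorem map_teichmuller (φ : A →+* B) (a : A) : map φ (teichmuller a) = teichmuller (φ a) :=
  mapFun_teichmuller φ a

theorem map_id : map (RingHom.id A) = RingHom.id (BigWitt A) := by
  ext f n; simp [series_map]

theorem map_comp (ψ : B →+* C) (φ : A →+* B) : map (ψ.comp φ) = (map ψ).comp (map φ) := by
  ext f n; simp [series_map]

/-- The big Witt vector `det (1 - T M)` of a square matrix. -/
noncomputable def ofMatrix {m : Type*} [Fintype m] [DecidableEq m] (M : Matrix m m A) :
    BigWitt A :=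
  ⟨M.charpolyRev, constantCoeff_charpolyRev M⟩

theorem map_ofMatrix {m : Type*} [Fintype m] [DecidableEq m] (φ : A →+* B) (M : Matrix m m A) :
    map φ (ofMatrix M) = ofMatrix (M.map φ) := by
  ext n
  simp [series_map, ofMatrix, charpolyRev_map]

theorem ofMatrix_mul {m n : Type*} [Fintype m] [DecidableEq m] [Fintype n] [DecidableEq n]
    (M : Matrix m m A) (N : Matrix n n A) : ofMatrix M * ofMatrix N = ofMatrix (M ⊗ₖ N) := by
  let φ := (MvPolynomial.aeval (R := ℤ) (id : A → A)).toRingHom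
  let M' : Matrix m m (MvPolynomial A ℤ) := M.map MvPolynomial.X
  let N' : Matrix n n (MvPolynomial A ℤ) := N.map MvPolynomial.X
  have hM : M'.map φ = M := by ext; simp [M', φ]
  have hN : N'.map φ = N := by ext; simp [N', φ]
  have hMN : (M' ⊗ₖ N').map φ = M ⊗ₖ N := by
    rw [← hM, ← hN]; ext; simp [Matrix.kroneckerMap_apply]
  have h : ofMatrix M' * ofMatrix N' = ofMatrix (M' ⊗ₖ N') := by
    refine eq_of_ghost
      (ghost_mul (isGhostSeries_charpolyRev M') (isGhostSeries_charpolyRev N'))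
      (isGhostSeries_charpolyRev (M' ⊗ₖ N')) fun k => ?_
    have hp : ∀ k, (M' ⊗ₖ N') ^ k = (M' ^ k) ⊗ₖ (N' ^ k) := by
      intro k
      induction k with
      | zero => simp
      | succ k ih => rw [pow_succ, ih, pow_succ, pow_succ, Matrix.mul_kronecker_mul]
    simp only [PowerSeries.coeff_mk, hp, Matrix.trace_kronecker]
    split_ifs <;> simp
  have h2 := congrArg (map φ) h
  rwa [map_mul, map_ofMatrix, map_ofMatrix, map_ofMatrix, hM, hN, hMN] at h2

end Basic

section Rational

/-- `f` is a polynomial. -/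
def IsPoly {A : Type*} [CommRing A] (f : BigWitt A) : Prop :=
  ∃ P : Polynomial A, f.series = P

theorem IsPoly.mul {A : Type*} [CommRing A] {f g : BigWitt A} (hf : f.IsPoly) (hg : g.IsPoly) :
    (f * g).IsPoly := by
  have key : ∀ {f : BigWitt A}, f.IsPoly → ∃ n, ∃ M : Matrix (Fin n) (Fin n) A,
      f = ofMatrix M := by
    rintro f ⟨P, hP⟩
    refine ⟨P.natDegree, bigWittCompanion P.natDegree f.series, BigWitt.ext ?_⟩
    change f.series = ((bigWittCompanion P.natDegree f.series).charpolyRev : PowerSeries A)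
    rw [charpolyRev_bigWittCompanion _ _ f.constantCoeff_series, hP,
      PowerSeries.trunc_coe_eq_self (by omega)]
  obtain ⟨m, M, rfl⟩ := key hf
  obtain ⟨n, N, rfl⟩ := key hg
  rw [ofMatrix_mul]
  exact ⟨_, rfl⟩

theorem IsPoly.add {A : Type*} [CommRing A] {f g : BigWitt A} (hf : f.IsPoly) (hg : g.IsPoly) :
    (f + g).IsPoly := by
  obtain ⟨P, hP⟩ := hf
  obtain ⟨Q, hQ⟩ := hg
  exact ⟨P * Q, by rw [series_add, hP, hQ, Polynomial.coe_mul]⟩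

theorem isPoly_teichmuller {A : Type*} [CommRing A] (a : A) : (teichmuller a).IsPoly :=
  ⟨1 - Polynomial.C a * Polynomial.X, by simp [teichmuller]⟩

theorem isPoly_zero {A : Type*} [CommRing A] : (0 : BigWitt A).IsPoly :=
  ⟨1, by simp [series_zero]⟩

/-- `f = P / Q` for polynomials `P`, `Q` with constant coefficient `1`. -/
def IsRational {A : Type*} [CommRing A] (f : BigWitt A) : Prop :=
  ∃ P Q : Polynomial A, P.coeff 0 = 1 ∧ Q.coeff 0 = 1 ∧
    f.series * (Q : PowerSeries A) = (P : PowerSeries A)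

theorem isRational_iff {A : Type*} [CommRing A] (f : BigWitt A) :
    f.IsRational ↔ ∃ p q : BigWitt A, p.IsPoly ∧ q.IsPoly ∧ f + q = p := by
  constructor
  · rintro ⟨P, Q, hP, hQ, h⟩
    exact ⟨⟨P, by simpa using hP⟩, ⟨Q, by simpa using hQ⟩, ⟨P, rfl⟩, ⟨Q, rfl⟩, BigWitt.ext h⟩
  · rintro ⟨p, q, ⟨P, hP⟩, ⟨Q, hQ⟩, h⟩
    refine ⟨P, Q, ?_, ?_, ?_⟩
    · have := p.constantCoeff_series; rw [hP] at this; simpa using this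
    · have := q.constantCoeff_series; rw [hQ] at this; simpa using this
    · rw [← hP, ← hQ, ← h, series_add]

theorem IsPoly.isRational {A : Type*} [CommRing A] {f : BigWitt A} (hf : f.IsPoly) :
    f.IsRational := (isRational_iff f).2 ⟨f, 0, hf, isPoly_zero, add_zero f⟩

theorem IsRational.map {A B : Type*} [CommRing A] [CommRing B] (φ : A →+* B) {f : BigWitt A}
    (hf : f.IsRational) : (map φ f).IsRational := by
  obtain ⟨P, Q, hP, hQ, h⟩ := hf
  refine ⟨P.map φ, Q.map φ, by simp [hP], by simp [hQ], ?_⟩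
  have := congrArg (PowerSeries.map φ) h
  simpa [series_map] using this

/-- The ring `W_rat(A)` of rational Witt vectors. -/
noncomputable def rational (A : Type*) [CommRing A] : Subring (BigWitt A) where
  carrier := {f | f.IsRational}
  zero_mem' := isPoly_zero.isRational
  one_mem' := (isPoly_teichmuller (1 : A)).isRational
  add_mem' {f g} hf hg := by
    obtain ⟨p, q, hp, hq, h⟩ := (isRational_iff f).1 hf
    obtain ⟨p', q', hp', hq', h'⟩ := (isRational_iff g).1 hg
    exact (isRational_iff _).2 ⟨p + p', q + q', hp.add hp', hq.add hq', by rw [← h, ← h']; ring⟩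
  neg_mem' {f} hf := by
    obtain ⟨p, q, hp, hq, h⟩ := (isRational_iff f).1 hf
    exact (isRational_iff _).2 ⟨q, p, hq, hp, by rw [← h]; ring⟩
  mul_mem' {f g} hf hg := by
    obtain ⟨p, q, hp, hq, h⟩ := (isRational_iff f).1 hf
    obtain ⟨p', q', hp', hq', h'⟩ := (isRational_iff g).1 hg
    refine (isRational_iff _).2 ⟨p * p' + q * q', p * q' + q * p', (hp.mul hp').add (hq.mul hq'),
      (hp.mul hq').add (hq.mul hp'), ?_⟩
    rw [← h, ← h']; ring

/-- The ring homomorphism `W_rat(A) → W_rat(B)` induced by `φ : A → B`. -/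
noncomputable def rationalMap {A B : Type*} [CommRing A] [CommRing B] (φ : A →+* B) :
    rational A →+* rational B :=
  (map φ).restrict (rational A) (rational B) fun _ hf => IsRational.map φ hf

end Rational

end BigWitt

/-- The reduced monoid ring `ℤA / ℤ(0)` of the multiplicative monoid of `A`. -/
abbrev ReducedMonoidRing (A : Type*) [CommRing A] : Type _ :=
  MonoidAlgebra ℤ A ⧸ Ideal.span {MonoidAlgebra.single (0 : A) (1 : ℤ)}

namespace ReducedMonoidRing

/-- The functoriality `(a) ↦ (φ a)` of the reduced monoid ring. -/
noncomputable def map {A B : Type*} [CommRing A] [CommRing B] (φ : A →+* B) :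
    ReducedMonoidRing A →+* ReducedMonoidRing B :=
  Ideal.quotientMap _ (MonoidAlgebra.mapDomainRingHom ℤ (φ : A →* B)) (by
    rw [Ideal.span_le, Set.singleton_subset_iff]
    refine Ideal.subset_span ?_
    simp [MonoidAlgebra.mapDomainRingHom])

/-- The homomorphism `ω : ℤA / ℤ(0) → W_rat(A)`, `(a) ↦ [a] = 1 - a T`. -/
noncomputable def toRational (A : Type*) [CommRing A] :
    ReducedMonoidRing A →+* BigWitt.rational A :=
  Ideal.Quotient.lift _
    (MonoidAlgebra.lift ℤ (BigWitt.rational A) A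
      { toFun := fun a => ⟨BigWitt.teichmuller a, (BigWitt.isPoly_teichmuller a).isRational⟩
        map_one' := rfl
        map_mul' := fun a b => Subtype.ext (BigWitt.teichmuller_mul a b) }).toRingHom
    (by
      intro x hx
      rw [← RingHom.mem_ker]
      refine (Ideal.span_le (I := RingHom.ker _)).2 ?_ hx
      rw [Set.singleton_subset_iff, SetLike.mem_coe, RingHom.mem_ker]
      refine Subtype.ext ?_
      simp [BigWitt.teichmuller_zero])

theorem ringHom_ext {A R : Type*} [CommRing A] [CommRing R] {f g : ReducedMonoidRing A →+* R}
    (h : ∀ a : A, f (Ideal.Quotient.mk _ (MonoidAlgebra.single a 1)) =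
      g (Ideal.Quotient.mk _ (MonoidAlgebra.single a 1))) : f = g := by
  refine Ideal.Quotient.ringHom_ext (MonoidAlgebra.ringHom_ext (fun n => ?_) h)
  have := RingHom.ext_iff.1 (RingHom.ext_int
    ((f.comp (Ideal.Quotient.mk _)).comp MonoidAlgebra.singleOneRingHom)
    ((g.comp (Ideal.Quotient.mk _)).comp MonoidAlgebra.singleOneRingHom)) n
  exact this

theorem map_single {A B : Type*} [CommRing A] [CommRing B] (φ : A →+* B) (a : A) :
    map φ (Ideal.Quotient.mk _ (MonoidAlgebra.single a 1)) =
      Ideal.Quotient.mk _ (MonoidAlgebra.single (φ a) 1) := by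
  simp [map, MonoidAlgebra.mapDomainRingHom]

theorem toRational_single {A : Type*} [CommRing A] (a : A) :
    (toRational A (Ideal.Quotient.mk _ (MonoidAlgebra.single a 1)) : BigWitt A) =
      BigWitt.teichmuller a := by
  simp [toRational]

theorem map_id {A : Type*} [CommRing A] :
    map (RingHom.id A) = RingHom.id (ReducedMonoidRing A) :=
  ringHom_ext fun a => by rw [map_single]; rfl

theorem map_comp {A B C : Type*} [CommRing A] [CommRing B] [CommRing C] (ψ : B →+* C)
    (φ : A →+* B) : map (ψ.comp φ) = (map ψ).comp (map φ) :=
  ringHom_ext fun a => by rw [RingHom.comp_apply, map_single, map_single, map_single]; rfl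

theorem toRational_naturality {A B : Type*} [CommRing A] [CommRing B] (φ : A →+* B) :
    (toRational B).comp (map φ) = (BigWitt.rationalMap φ).comp (toRational A) :=
  ringHom_ext fun a => Subtype.ext <| by
    rw [RingHom.comp_apply, map_single, toRational_single]
    change _ = BigWitt.map φ (toRational A _ : BigWitt A)
    rw [toRational_single, BigWitt.map_teichmuller]

end ReducedMonoidRing

theorem sum_mem_of_coset_sums_mem {A G T : Type*} [CommRing A] [Group G] [Fintype G] [Group T]
    [Fintype T] (φ : T →* G) (hφ : Function.Injective φ) (t : G → A) (I : Ideal A)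
    (h : ∀ σ, ∑ τ, t (σ * φ τ) ∈ I) : ∑ σ, t σ ∈ I := by
  classical
  have : Fintype (G ⧸ φ.range) := Fintype.ofFinite _
  have hmk : ∀ (q : G ⧸ φ.range) (y : T), ((q.out * φ y : G) : G ⧸ φ.range) = q :=
    fun q y => by rw [QuotientGroup.mk_mul_of_mem _ (MonoidHom.mem_range.2 ⟨y, rfl⟩), QuotientGroup.out_eq']
  have hb : Function.Bijective (fun p : (G ⧸ φ.range) × T => p.1.out * φ p.2) := by
    constructor
    · rintro ⟨q, y⟩ ⟨q', y'⟩ hp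
      have hp' : q.out * φ y = q'.out * φ y' := hp
      obtain rfl : q = q' := by rw [← hmk q y, ← hmk q' y', hp']
      exact Prod.ext rfl (hφ (mul_left_cancel hp'))
    · intro σ
      have hσ : (σ : G ⧸ φ.range).out⁻¹ * σ ∈ φ.range := by
        rw [← QuotientGroup.eq, QuotientGroup.out_eq']
      obtain ⟨y, hy⟩ := hσ
      exact ⟨⟨σ, y⟩, by simp [hy]⟩
  rw [← hb.sum_comp t, Fintype.sum_prod_type]
  exact Ideal.sum_mem _ fun q _ => h q.out

theorem det_mem_pow_of_minors_mem {A : Type*} [CommRing A] (I : Ideal A) (k n : ℕ)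
    (M : Matrix (Fin k × Fin n) (Fin k × Fin n) A)
    (h : ∀ r c : Fin n → Fin k × Fin n, (M.submatrix r c).det ∈ I) : M.det ∈ I ^ k := by
  let φ : (Fin k → Equiv.Perm (Fin n)) →* Equiv.Perm (Fin k × Fin n) :=
    { toFun := Equiv.prodCongrRight
      map_one' := by ext x <;> rfl
      map_mul' := fun _ _ => by ext x <;> rfl }
  have hφ : Function.Injective φ := by
    intro a b hab
    ext i j : 2
    have := congrArg (fun e : Equiv.Perm (Fin k × Fin n) => (e (i, j)).2) hab
    exact this
  rw [Matrix.det_apply]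
  refine sum_mem_of_coset_sums_mem φ hφ _ _ fun σ => ?_
  have h3 : ∀ τ : Fin k → Equiv.Perm (Fin n),
      Equiv.Perm.sign (σ * φ τ) • ∏ x, M ((σ * φ τ) x) x =
      Equiv.Perm.sign σ • ∏ b, (Equiv.Perm.sign (τ b) • ∏ j, M (σ (b, τ b j)) (b, j)) := by
    intro τ
    simp only [Units.smul_def, zsmul_eq_mul, Finset.prod_mul_distrib, Fintype.prod_prod_type]
    rw [Equiv.Perm.sign_mul, show Equiv.Perm.sign (φ τ) = ∏ b, Equiv.Perm.sign (τ b) from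
      Equiv.Perm.sign_prodCongrRight τ, ← mul_assoc]
    push_cast
    rfl
  simp only [h3, ← Finset.smul_sum]
  rw [← Fintype.prod_sum (fun b (τ : Equiv.Perm (Fin n)) =>
    Equiv.Perm.sign τ • ∏ j, M (σ (b, τ j)) (b, j))]
  rw [Units.smul_def, zsmul_eq_mul]
  refine Ideal.mul_mem_left _ _ ?_
  have h4 : ∀ b : Fin k, ∑ τ : Equiv.Perm (Fin n),
      Equiv.Perm.sign τ • ∏ j, M (σ (b, τ j)) (b, j) ∈ I := by
    intro b
    have := h (fun j => σ (b, j)) (fun j => (b, j))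
    rwa [Matrix.det_apply] at this
  have := Ideal.prod_mem_prod (s := (Finset.univ : Finset (Fin k))) (I := fun _ => I)
    fun b _ => h4 b
  simpa using this

namespace BigWitt

section Hankel

/-- All `(n + 1) × (n + 1)` minors of the Hankel matrix `H(f) = (a_{i+j})_{i, j ≥ 0}` vanish,
where `f = 1 + a₁ T + a₂ T² + ⋯` and `a₀ = 1`, i.e. `rk H(f) ≤ n`. (Minors with repeated or permuted
rows or columns are zero or equal up to sign to genuine minors.) -/
def HankelRankLE {A : Type*} [CommRing A] (n : ℕ) (f : BigWitt A) : Prop :=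
  ∀ r c : Fin (n + 1) → ℕ,
    (Matrix.of fun i j => PowerSeries.coeff (r i + c j) f.series).det = 0

/-- `rk H(f) < ∞`. -/
def HankelFinite {A : Type*} [CommRing A] (f : BigWitt A) : Prop := ∃ n, f.HankelRankLE n

theorem HankelRankLE.mono {A : Type*} [CommRing A] {f : BigWitt A} {n m : ℕ}
    (h : f.HankelRankLE n) (hnm : n ≤ m) : f.HankelRankLE m := by
  induction m, hnm using Nat.le_induction with
  | base => exact h
  | succ m _ ih =>
    intro r c
    rw [Matrix.det_succ_row_zero]
    refine Finset.sum_eq_zero fun j _ => ?_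
    have := ih (r ∘ Fin.succ) (c ∘ j.succAbove)
    rw [show ((Matrix.of fun i j => PowerSeries.coeff (r i + c j) f.series).submatrix Fin.succ
      j.succAbove).det = 0 from this, mul_zero]

theorem HankelRankLE.map {A B : Type*} [CommRing A] [CommRing B] (φ : A →+* B) {f : BigWitt A}
    {n : ℕ} (h : f.HankelRankLE n) : (map φ f).HankelRankLE n := by
  intro r c
  have := congrArg φ (h r c)
  rw [RingHom.map_det, map_zero] at this
  rw [← this]
  congr 1

theorem IsRational.hankelFinite {A : Type*} [CommRing A] {f : BigWitt A} (hf : f.IsRational) :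
    f.HankelFinite := by
  obtain ⟨P, Q, -, hQ, h⟩ := hf
  let d := max (P.natDegree + 1) Q.natDegree
  have hrec : ∀ m, d ≤ m → PowerSeries.coeff m f.series =
      -∑ s ∈ Finset.range d, Q.coeff (s + 1) * PowerSeries.coeff (m - 1 - s) f.series := by
    intro m hm
    have hd : P.natDegree + 1 ≤ d := le_max_left _ _
    have hd' : Q.natDegree ≤ d := le_max_right _ _
    have e := congrArg (PowerSeries.coeff m) h
    rw [Polynomial.coeff_coe, Polynomial.coeff_eq_zero_of_natDegree_lt (by omega), mul_comm,
      PowerSeries.coeff_mul, Finset.Nat.sum_antidiagonal_eq_sum_range_succ_mk,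
      Finset.sum_range_succ'] at e
    simp only [Polynomial.coeff_coe, hQ, one_mul, Nat.sub_zero] at e
    rw [eq_neg_iff_add_eq_zero, ← e, add_comm]
    congr 1
    have hsub : Finset.range d ⊆ Finset.range m := Finset.range_subset_range.2 hm
    rw [← Finset.sum_subset hsub]
    · refine Finset.sum_congr rfl fun s _ => ?_
      rw [Nat.sub_sub, add_comm 1 s]
    · intro s _ hs
      rw [Polynomial.coeff_eq_zero_of_natDegree_lt, zero_mul]
      simp only [Finset.mem_range] at hs
      omega
  have hC : ∀ i, ∃ c : Fin (d + 1) → A, c (Fin.last d) = 0 ∧ ∀ j,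
      PowerSeries.coeff (i + j) f.series = ∑ t, c t * PowerSeries.coeff (t + j) f.series := by
    intro i
    induction i using Nat.strong_induction_on with
    | _ i ih =>
      by_cases hi : i < d
      · refine ⟨Pi.single ⟨i, by omega⟩ 1, ?_, fun j => ?_⟩
        · rw [Pi.single_eq_of_ne]
          intro hh
          have := congrArg Fin.val hh
          simp at this
          omega
        · simp [Pi.single_apply]
      · have hd1 : 1 ≤ d := le_trans (by omega) (le_max_left _ _)
        choose! c hc0 hc using ih
        refine ⟨fun t => -∑ s ∈ Finset.range d, Q.coeff (s + 1) * c (i - 1 - s) t, ?_, fun j => ?_⟩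
        · rw [neg_eq_zero]
          refine Finset.sum_eq_zero fun s _ => ?_
          rw [hc0 _ (by omega), mul_zero]
        · rw [hrec (i + j) (by omega)]
          simp only [neg_mul, Finset.sum_neg_distrib, Finset.sum_mul]
          rw [Finset.sum_comm]
          congr 1
          refine Finset.sum_congr rfl fun s hs => ?_
          rw [Finset.mem_range] at hs
          rw [show i + j - 1 - s = (i - 1 - s) + j by omega, hc _ (by omega), Finset.mul_sum]
          exact Finset.sum_congr rfl fun t _ => (mul_assoc _ _ _).symm
  choose C hC0 hC using hC
  refine ⟨d, fun r c => ?_⟩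
  have : (Matrix.of fun i j => PowerSeries.coeff (r i + c j) f.series) =
      (Matrix.of fun i t => C (r i) t) *
        (Matrix.of fun (t : Fin (d + 1)) j => PowerSeries.coeff (t + c j) f.series) := by
    ext i j
    simp only [Matrix.of_apply, Matrix.mul_apply]
    exact hC _ _
  rw [this, Matrix.det_mul, Matrix.det_eq_zero_of_column_eq_zero (Fin.last d), zero_mul]
  exact fun i => hC0 _

theorem HankelFinite.isRational {K : Type*} [Field K] {f : BigWitt K} (hf : f.HankelFinite) :
    f.IsRational := by
  obtain ⟨n, hn⟩ := hf
  let w : ℕ → (Fin (n + 1) → K) := fun j i => PowerSeries.coeff (i + j) f.series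
  have hspan : Submodule.span K (Set.range w) ≠ ⊤ := by
    intro htop
    obtain ⟨b, hb, hbs, hli⟩ := exists_linearIndependent K (Set.range w)
    rw [htop] at hbs
    let B : Module.Basis b K (Fin (n + 1) → K) :=
      Module.Basis.mk hli (by rw [Subtype.range_coe, hbs])
    let e : b ≃ Fin (n + 1) := B.indexEquiv (Pi.basisFun K (Fin (n + 1)))
    choose c hc using fun j => hb (e.symm j).2
    have hli' : LinearIndependent K (fun j => w (c j)) := by
      rw [show (fun j => w (c j)) = Subtype.val ∘ e.symm from funext hc]
      exact hli.comp e.symm e.symm.injective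
    have hdet := hn (fun i => i) c
    have hunit : IsUnit (Matrix.of fun i j => PowerSeries.coeff ((i : Fin (n + 1)) + c j) f.series) := by
      rw [← Matrix.linearIndependent_cols_iff_isUnit]
      exact hli'
    rw [Matrix.isUnit_iff_isUnit_det, hdet] at hunit
    exact not_isUnit_zero hunit
  obtain ⟨φ, hφ, hle⟩ := Submodule.exists_le_ker_of_lt_top _ (lt_top_iff_ne_top.2 hspan)
  let q : Fin (n + 1) → K := fun i => φ (Pi.single i 1)
  have hq : ∀ v, φ v = ∑ i, q i * v i := by
    intro v
    conv_lhs => rw [← Finset.univ_sum_single v]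
    rw [map_sum]
    refine Finset.sum_congr rfl fun i _ => ?_
    rw [show Pi.single i (v i) = v i • (Pi.single i 1 : Fin (n + 1) → K) by
      rw [← Pi.single_smul]; simp, map_smul, smul_eq_mul, mul_comm]
  have hrel : ∀ j, ∑ i, q i * PowerSeries.coeff (i + j) f.series = 0 := by
    intro j
    rw [← hq (w j)]
    exact hle (Submodule.subset_span ⟨j, rfl⟩)
  let Q : Polynomial K := ∑ i : Fin (n + 1), Polynomial.C (q i) * Polynomial.X ^ (n - i : ℕ)
  have hQ : Q ≠ 0 := by
    intro h0
    apply hφ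
    ext v
    rw [LinearMap.comp_apply, LinearMap.single_apply, LinearMap.zero_comp, LinearMap.zero_apply]
    have := congrArg (fun p => Polynomial.coeff p (n - v)) h0
    simp only [Q, Polynomial.finsetSum_coeff, Polynomial.coeff_C_mul, Polynomial.coeff_X_pow,
      Polynomial.coeff_zero] at this
    rw [Finset.sum_eq_single v] at this
    · simpa using this
    · intro i _ hi
      rw [if_neg, mul_zero]
      intro h
      apply hi
      ext
      omega
    · simp
  have hQf : ∀ m, n ≤ m → PowerSeries.coeff m ((Q : PowerSeries K) * f.series) = 0 := by
    intro m hm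
    have hQs : (Q : PowerSeries K) =
        ∑ i : Fin (n + 1), PowerSeries.C (q i) * PowerSeries.X ^ (n - i : ℕ) := by
      change Polynomial.coeToPowerSeries.ringHom Q = _
      simp [Q]
    rw [hQs, Finset.sum_mul, map_sum, ← hrel (m - n)]
    refine Finset.sum_congr rfl fun i _ => ?_
    rw [mul_assoc, PowerSeries.coeff_C_mul, PowerSeries.coeff_X_pow_mul', if_pos (by omega)]
    have := i.2
    rw [show m - (n - i) = i + (m - n) by omega]
  obtain ⟨Q₀, hQ₀, hX⟩ := Polynomial.exists_eq_pow_rootMultiplicity_mul_and_not_dvd Q hQ 0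
  set s := Q.rootMultiplicity 0
  rw [map_zero, sub_zero] at hQ₀ hX
  rw [Polynomial.X_dvd_iff] at hX
  have hQ₀f : ∀ m, n ≤ m → PowerSeries.coeff m ((Q₀ : PowerSeries K) * f.series) = 0 := by
    intro m hm
    have := hQf (m + s) (by omega)
    rwa [hQ₀, Polynomial.coe_mul, Polynomial.coe_pow, Polynomial.coe_X, mul_assoc,
      PowerSeries.coeff_X_pow_mul] at this
  let Q₁ : Polynomial K := Polynomial.C (Q₀.coeff 0)⁻¹ * Q₀
  have hP : f.series * (Q₁ : PowerSeries K) =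
      (PowerSeries.trunc n (f.series * (Q₁ : PowerSeries K)) : PowerSeries K) := by
    ext m
    rw [Polynomial.coeff_coe, PowerSeries.coeff_trunc]
    split_ifs with hm
    · rfl
    · rw [mul_comm, Polynomial.coe_mul, Polynomial.coe_C, mul_assoc, PowerSeries.coeff_C_mul,
        hQ₀f m (by omega), mul_zero]
  have hQ₁ : Q₁.coeff 0 = 1 := by
    rw [Polynomial.coeff_C_mul, inv_mul_cancel₀ hX]
  refine ⟨_, Q₁, ?_, hQ₁, hP⟩
  rw [← Polynomial.coeff_coe, ← hP, PowerSeries.coeff_zero_eq_constantCoeff_apply, map_mul,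
    f.constantCoeff_series, one_mul, ← PowerSeries.coeff_zero_eq_constantCoeff_apply,
    Polynomial.coeff_coe, hQ₁]

/-- Over a Noetherian ring, finiteness of the Hankel rank can be tested at the minimal primes. -/
theorem hankelFinite_iff {A : Type*} [CommRing A] [IsNoetherianRing A] (f : BigWitt A) :
    f.HankelFinite ↔ ∀ p : PrimeSpectrum A, p.asIdeal ∈ minimalPrimes A →
      (map (algebraMap A p.asIdeal.ResidueField) f).IsRational := by
  constructor
  · rintro ⟨n, hn⟩ p _
    exact HankelFinite.isRational ⟨n, hn.map _⟩
  · intro h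
    have h1 : ∀ p : PrimeSpectrum A, p.asIdeal ∈ minimalPrimes A →
        ∃ n, (map (algebraMap A p.asIdeal.ResidueField) f).HankelRankLE n :=
      fun p hp => (h p hp).hankelFinite
    choose! N hN using h1
    have hfin : {p : PrimeSpectrum A | p.asIdeal ∈ minimalPrimes A}.Finite :=
      (minimalPrimes.finite_of_isNoetherianRing A).preimage
        (fun p _ q _ hpq => PrimeSpectrum.ext hpq)
    obtain ⟨n, hn⟩ := (hfin.image N).bddAbove
    have hminor : ∀ r c : Fin (n + 1) → ℕ,
        (Matrix.of fun i j => PowerSeries.coeff (r i + c j) f.series).det ∈ nilradical A := by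
      intro r c
      rw [nilradical, ← Ideal.sInf_minimalPrimes, Submodule.mem_sInf]
      intro (p : Ideal A) hp
      have : p.IsPrime := hp.1.1
      let p' : PrimeSpectrum A := ⟨p, this⟩
      have hz := (hN p' hp).mono (hn ⟨p', hp, rfl⟩) r c
      rw [← Ideal.algebraMap_residueField_eq_zero (I := p), RingHom.map_det, ← hz]
      congr 1
    obtain ⟨k, hk⟩ := IsNoetherianRing.isNilpotent_nilradical A
    refine ⟨(k + 1) * (n + 1) - 1, fun r c => ?_⟩
    have hcard : (k + 1) * (n + 1) = (k + 1) * (n + 1) - 1 + 1 := by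
      have : 0 < (k + 1) * (n + 1) := by positivity
      omega
    let e : Fin (k + 1) × Fin (n + 1) ≃ Fin ((k + 1) * (n + 1) - 1 + 1) :=
      finProdFinEquiv.trans (finCongr hcard)
    rw [← Matrix.det_submatrix_equiv_self e]
    have := det_mem_pow_of_minors_mem (nilradical A) (k + 1) (n + 1)
      ((Matrix.of fun i j => PowerSeries.coeff (r i + c j) f.series).submatrix e e) (fun r' c' =>
      hminor (r ∘ e ∘ r') (c ∘ e ∘ c'))
    rw [pow_succ, hk, zero_mul] at this
    exact this

/-- The ring `W_J(A)` of big Witt vectors whose Hankel matrix has finite rank, for Noetherian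
rings `A`. -/
noncomputable def hankel (A : Type*) [CommRing A] [IsNoetherianRing A] : Subring (BigWitt A) where
  carrier := {f | f.HankelFinite}
  zero_mem' := isPoly_zero.isRational.hankelFinite
  one_mem' := (isPoly_teichmuller (1 : A)).isRational.hankelFinite
  add_mem' {f g} hf hg := (hankelFinite_iff _).2 fun p hp => by
    rw [map_add]
    exact (rational _).add_mem ((hankelFinite_iff f).1 hf p hp) ((hankelFinite_iff g).1 hg p hp)
  neg_mem' {f} hf := (hankelFinite_iff _).2 fun p hp => by
    rw [map_neg]
    exact (rational _).neg_mem ((hankelFinite_iff f).1 hf p hp)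
  mul_mem' {f g} hf hg := (hankelFinite_iff _).2 fun p hp => by
    rw [map_mul]
    exact (rational _).mul_mem ((hankelFinite_iff f).1 hf p hp) ((hankelFinite_iff g).1 hg p hp)

theorem rational_le_hankel (A : Type*) [CommRing A] [IsNoetherianRing A] :
    rational A ≤ hankel A := fun _ hf => IsRational.hankelFinite hf

/-- The ring homomorphism `W_J(A) → W_J(B)` induced by `φ : A → B`. -/
noncomputable def hankelMap {A B : Type*} [CommRing A] [CommRing B] [IsNoetherianRing A]
    [IsNoetherianRing B] (φ : A →+* B) : hankel A →+* hankel B :=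
  (map φ).restrict (hankel A) (hankel B) fun _ ⟨n, hn⟩ => ⟨n, hn.map φ⟩

end Hankel
end BigWitt

/-- A pretopology on a category which need not have all fibre products: a class of covering families
`{Y i ⟶ X}` such that isomorphisms are coverings, coverings of the members of a covering
compose, and the base change of a covering along any `X' ⟶ X` exists and is a covering. -/
structure FamilyPretopology (C : Type u) [Category.{v} C] where
  /-- `Cov X Y f` means that the family `f i : Y i ⟶ X` is a covering of `X`. -/
  Cov : ∀ (X : C) {ι : Type w} (Y : ι → C), (∀ i, Y i ⟶ X) → Prop
  iso_mem : ∀ {X Y : C} (e : Y ⟶ X) [IsIso e], Cov X (fun _ : PUnit => Y) (fun _ => e)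
  comp_mem : ∀ {X : C} {ι : Type w} {Y : ι → C} {f : ∀ i, Y i ⟶ X}, Cov X Y f →
    ∀ {κ : ι → Type w} {Z : ∀ i, κ i → C} {g : ∀ i k, Z i k ⟶ Y i},
      (∀ i, Cov (Y i) (Z i) (g i)) →
        Cov X (fun p : Σ i, κ i => Z p.1 p.2) (fun p => g p.1 p.2 ≫ f p.1)
  exists_baseChange : ∀ {X : C} {ι : Type w} {Y : ι → C} {f : ∀ i, Y i ⟶ X}, Cov X Y f →
    ∀ {X' : C} (g : X' ⟶ X), ∃ (Y' : ι → C) (f' : ∀ i, Y' i ⟶ X') (g' : ∀ i, Y' i ⟶ Y i),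
      (∀ i, IsPullback (f' i) (g' i) g (f i)) ∧ Cov X' Y' f'

namespace FamilyPretopology

/-- The Grothendieck topology generated by a pretopology: a sieve is covering if and only if it
contains a covering family. -/
def toGrothendieck {C : Type u} [Category.{v} C] (τ : FamilyPretopology.{u, v, w} C) :
    GrothendieckTopology C where
  sieves X := {S | ∃ (ι : Type w) (Y : ι → C) (f : ∀ i, Y i ⟶ X), τ.Cov X Y f ∧ ∀ i, S (f i)}
  top_mem' X := ⟨PUnit, _, _, τ.iso_mem (𝟙 X), fun _ => trivial⟩
  pullback_stable' := by
    rintro X X' S g ⟨ι, Y, f, hf, hS⟩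
    obtain ⟨Y', f', g', hp, hf'⟩ := τ.exists_baseChange hf g
    exact ⟨ι, Y', f', hf', fun i => by
      change S (f' i ≫ g)
      rw [(hp i).w]
      exact S.downward_closed (hS i) _⟩
  transitive' := by
    rintro X S ⟨ι, Y, f, hf, hS⟩ R hR
    choose κ Z g hg hgR using fun i => hR (hS i)
    exact ⟨_, _, _, τ.comp_mem hf hg, fun p => hgR p.1 p.2⟩

end FamilyPretopology

/-- The category of Noetherian affine schemes. -/
abbrev NoethAffSch : Type (u + 1) :=
  ObjectProperty.FullSubcategory fun X : Scheme.{u} => IsAffine X ∧ IsNoetherian X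

namespace NoethAffSch

/-- The family of morphisms `f i : Y i ⟶ X` is jointly surjective. -/
def JointlySurjective {X : NoethAffSch.{u}} {ι : Type w} {Y : ι → NoethAffSch.{u}}
    (f : ∀ i, Y i ⟶ X) : Prop :=
  ∀ x : X.obj, ∃ (i : ι) (y : (Y i).obj), (f i).hom y = x

theorem isFinite_baseChange {X Y X' : NoethAffSch.{u}} (f : Y ⟶ X) (g : X' ⟶ X)
    (hf : IsFinite f.hom) : ∃ (Y' : NoethAffSch.{u}) (f' : Y' ⟶ X') (g' : Y' ⟶ Y),
      IsPullback f' g' g f ∧ IsFinite f'.hom ∧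
        ∀ (x : X'.obj) (y : Y.obj), f.hom y = g.hom x → ∃ y' : Y'.obj, f'.hom y' = x := by
  have : IsAffine X'.obj := X'.property.1
  have : IsNoetherian X'.obj := X'.property.2
  let P := Limits.pullback g.hom f.hom
  have hfin : IsFinite (Limits.pullback.fst g.hom f.hom) := inferInstance
  have hA : IsAffine P := isAffine_of_isAffineHom (Limits.pullback.fst g.hom f.hom)
  have hN : IsLocallyNoetherian P :=
    LocallyOfFiniteType.isLocallyNoetherian (Limits.pullback.fst g.hom f.hom)
  have hN' : IsNoetherian P := { }
  refine ⟨⟨P, hA, hN'⟩, ObjectProperty.homMk (Limits.pullback.fst g.hom f.hom),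
    ObjectProperty.homMk (Limits.pullback.snd g.hom f.hom), ?_, hfin, ?_⟩
  · refine IsPullback.of_map (ObjectProperty.ι _) ?_ (IsPullback.of_hasPullback g.hom f.hom)
    exact ObjectProperty.hom_ext _ Limits.pullback.condition
  · intro x y hxy
    obtain ⟨z, hz, -⟩ := Scheme.Pullback.exists_preimage_pullback x y hxy.symm
    exact ⟨z, hz⟩

/-- The `f`-pretopology: the coverings are the jointly surjective families of finite morphisms. -/
def finitePretopology : FamilyPretopology.{u + 1, u, w} NoethAffSch.{u} where
  Cov _ _ _ f := (∀ i, IsFinite (f i).hom) ∧ JointlySurjective f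
  iso_mem {X Y} e _ := by
    have : IsIso e.hom := inferInstanceAs (IsIso ((ObjectProperty.ι _).map e))
    exact ⟨fun _ => inferInstance, fun x => ⟨⟨⟩, e.hom.surjective x⟩⟩
  comp_mem := by
    rintro X ι Y f ⟨hf, hfs⟩ κ Z g hg
    refine ⟨fun p => ?_, fun x => ?_⟩
    · have := hf p.1
      have := (hg p.1).1 p.2
      exact inferInstanceAs (IsFinite ((g p.1 p.2).hom ≫ (f p.1).hom))
    · obtain ⟨i, y, rfl⟩ := hfs x
      obtain ⟨k, z, rfl⟩ := (hg i).2 y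
      exact ⟨⟨i, k⟩, z, by simp⟩
  exists_baseChange := by
    rintro X ι Y f ⟨hf, hfs⟩ X' g
    choose Y' f' g' hp hfin hsurj using fun i => isFinite_baseChange (f i) g (hf i)
    refine ⟨Y', f', g', hp, hfin, fun x => ?_⟩
    obtain ⟨i, y, hy⟩ := hfs (g.hom x)
    obtain ⟨z, hz⟩ := hsurj i x y hy
    exact ⟨i, z, hz⟩

/-- The presheaf of rings `𝒪 : X ↦ Γ(X, 𝒪_X)`. -/
noncomputable def structurePresheaf : NoethAffSch.{u}ᵒᵖ ⥤ CommRingCat.{u} :=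
  (ObjectProperty.ι _).op ⋙ Scheme.Γ

instance (X : NoethAffSch.{u}ᵒᵖ) : IsNoetherianRing (structurePresheaf.obj X) := by
  have : IsAffine X.unop.obj := X.unop.property.1
  have : IsNoetherian X.unop.obj := X.unop.property.2
  exact IsLocallyNoetherian.component_noetherian ⟨⊤, isAffineOpen_top X.unop.obj⟩

/-- The presheaf `ℤ(𝒪) / ℤ(0)` of reduced monoid rings. -/
noncomputable def monoidRingPresheaf : NoethAffSch.{u}ᵒᵖ ⥤ CommRingCat.{u} where
  obj X := CommRingCat.of (ReducedMonoidRing (structurePresheaf.obj X))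
  map f := CommRingCat.ofHom (ReducedMonoidRing.map (structurePresheaf.map f).hom)
  map_id X := by
    rw [structurePresheaf.map_id, CommRingCat.hom_id, ReducedMonoidRing.map_id]
    rfl
  map_comp f g := by
    rw [structurePresheaf.map_comp, CommRingCat.hom_comp, ReducedMonoidRing.map_comp]
    rfl

/-- The presheaf `W(𝒪)` of big Witt vectors. -/
noncomputable def wittPresheaf : NoethAffSch.{u}ᵒᵖ ⥤ CommRingCat.{u} where
  obj X := CommRingCat.of (BigWitt (structurePresheaf.obj X))
  map f := CommRingCat.ofHom (BigWitt.map (structurePresheaf.map f).hom)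
  map_id X := by
    rw [structurePresheaf.map_id, CommRingCat.hom_id, BigWitt.map_id]
    rfl
  map_comp f g := by
    rw [structurePresheaf.map_comp, CommRingCat.hom_comp, BigWitt.map_comp]
    rfl

/-- The presheaf `W_rat(𝒪)` of rational Witt vectors. -/
noncomputable def rationalPresheaf : NoethAffSch.{u}ᵒᵖ ⥤ CommRingCat.{u} where
  obj X := CommRingCat.of (BigWitt.rational (structurePresheaf.obj X))
  map f := CommRingCat.ofHom (BigWitt.rationalMap (structurePresheaf.map f).hom)
  map_id X := by
    refine CommRingCat.hom_ext (RingHom.ext fun x => ?_)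
    exact Subtype.ext (congrArg (fun φ => φ.hom x.1) (wittPresheaf.map_id X))
  map_comp f g := by
    refine CommRingCat.hom_ext (RingHom.ext fun x => ?_)
    exact Subtype.ext (congrArg (fun φ => φ.hom x.1) (wittPresheaf.map_comp f g))

/-- The presheaf `W_J(𝒪)` of big Witt vectors with Hankel matrix of finite rank. -/
noncomputable def hankelPresheaf : NoethAffSch.{u}ᵒᵖ ⥤ CommRingCat.{u} where
  obj X := CommRingCat.of (BigWitt.hankel (structurePresheaf.obj X))
  map f := CommRingCat.ofHom (BigWitt.hankelMap (structurePresheaf.map f).hom)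
  map_id X := by
    refine CommRingCat.hom_ext (RingHom.ext fun x => ?_)
    exact Subtype.ext (congrArg (fun φ => φ.hom x.1) (wittPresheaf.map_id X))
  map_comp f g := by
    refine CommRingCat.hom_ext (RingHom.ext fun x => ?_)
    exact Subtype.ext (congrArg (fun φ => φ.hom x.1) (wittPresheaf.map_comp f g))

/-- `ω : ℤ(𝒪) / ℤ(0) ⟶ W_rat(𝒪)`, `(a) ↦ 1 - a T`. -/
noncomputable def monoidRingToRational : monoidRingPresheaf.{u} ⟶ rationalPresheaf.{u} where
  app X := CommRingCat.ofHom (ReducedMonoidRing.toRational (structurePresheaf.obj X))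
  naturality X Y f := by
    ext1
    exact (ReducedMonoidRing.toRational_naturality (structurePresheaf.map f).hom)

/-- The inclusion `W_rat(𝒪) ⟶ W_J(𝒪)`. -/
noncomputable def rationalToHankel : rationalPresheaf.{u} ⟶ hankelPresheaf.{u} where
  app _ := CommRingCat.ofHom (Subring.inclusion (BigWitt.rational_le_hankel _))
  naturality _ _ _ := rfl

/-- The inclusion `W_J(𝒪) ⟶ W(𝒪)`. -/
noncomputable def hankelToWitt : hankelPresheaf.{u} ⟶ wittPresheaf.{u} where
  app _ := CommRingCat.ofHom (BigWitt.hankel _).subtype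
  naturality _ _ _ := rfl

/-- Rings in `Type u` regarded as rings in `Type (u + 1)`. -/
noncomputable def ringULift : CommRingCat.{u} ⥤ CommRingCat.{u + 1} where
  obj A := CommRingCat.of (ULift.{u + 1} A)
  map f := CommRingCat.ofHom
    ((ULift.ringEquiv.symm.toRingHom.comp f.hom).comp ULift.ringEquiv.toRingHom)
  map_id _ := rfl
  map_comp _ _ := rfl

/-- The sheafification functor `F ↦ F^♯` from presheaves of rings to sheaves of rings. -/
noncomputable def sharp (J : GrothendieckTopology NoethAffSch.{u}) :
    (NoethAffSch.{u}ᵒᵖ ⥤ CommRingCat.{u}) ⥤ Sheaf J CommRingCat.{u + 1} :=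
  (Functor.whiskeringRight _ _ _).obj ringULift ⋙ presheafToSheaf J CommRingCat.{u + 1}

end NoethAffSch

/-! Sheafification inverts a morphism of presheaves that is bijective up to refinement along
coverings, so everything reduces to algebra over a Noetherian ring `A`.

For `W_rat ⊂ W_J` only surjectivity is at stake, and nilpotents are the only obstruction. The closed
immersion of the reduced subscheme is a homeomorphism, hence a covering, and over a reduced
Noetherian ring the two rings agree (`HankelFinite.isRational_of_isReduced`). There the coefficient
sequence of `f` satisfies a linear recurrence over the residue field of each minimal prime, since
finite Hankel rank over a field means rationality. Since `A` embeds in the product of these finitely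
many fields, the `A`-span of the shifts of the sequence embeds in some `A^d`. It is therefore a
finite module, and Cayley–Hamilton for the shift yields a monic recurrence over `A` itself.

For `ω`, local surjectivity comes from splitting: the reversal of a polynomial `P` with `P(0) = 1`
is monic, so it splits over a finite injective extension `B`. There `P` becomes a product of factors
`1 - bT`, that is, a sum of Teichmüller elements (`IsRational.exists_finite_map_mem`). A finite
injective map is surjective on spectra, so `Spec B` is an `f`-covering. Local injectivity follows by
covering `Spec A` with its irreducible components `Spec A/q`: over a domain `ω` is injective,
because the numbers `1/b` are roots that can be told apart in the fraction field
(`toRational_injective`).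

Finally, `W_J ⊂ W` is injective on presheaves, and sheafification preserves injectivity; the other
two maps to `W` follow. -/

namespace BigWitt

/-! ### Linear recurrences and rationality over reduced Noetherian rings -/

/-- The shift `(xₖ)ₖ ↦ (xₖ₊₁)ₖ` of sequences. -/
def seqShift (A : Type*) [CommRing A] : (ℕ → A) →ₗ[A] (ℕ → A) :=
  LinearMap.funLeft A A Nat.succ

theorem seqShift_pow_apply {A : Type*} [CommRing A] (j : ℕ) (x : ℕ → A) (k : ℕ) :
    (seqShift A ^ j) x k = x (k + j) := by
  induction j generalizing k with
  | zero => rfl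
  | succ j ih =>
    rw [pow_succ', Module.End.mul_apply]
    change (seqShift A ^ j) x (k + 1) = _
    rw [ih, show k + 1 + j = k + (j + 1) by omega]

/-- A sequence annihilated by a monic polynomial in the shift is the coefficient sequence of a
rational series. -/
theorem isRational_of_aeval_seqShift {A : Type*} [CommRing A] {f : BigWitt A} {χ : Polynomial A}
    (hχ : χ.Monic)
    (h : Polynomial.aeval (seqShift A) χ (fun k => PowerSeries.coeff k f.series) = 0) :
    f.IsRational := by
  set N := χ.natDegree
  have hrec : ∀ k, ∑ i ∈ Finset.range (N + 1), χ.coeff i * PowerSeries.coeff (k + i) f.series = 0 := by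
    intro k
    have := congrFun h k
    rw [Polynomial.aeval_eq_sum_range, LinearMap.sum_apply, Finset.sum_apply] at this
    rw [← Pi.zero_apply (M := fun _ : ℕ => A) k, ← this]
    refine Finset.sum_congr rfl fun i _ => ?_
    rw [LinearMap.smul_apply, Pi.smul_apply, seqShift_pow_apply, smul_eq_mul]
  -- Reversing the characteristic polynomial gives the denominator: for `m ≥ N`, the coefficient of
  -- `T^m` in `f Q` is the recurrence at `k = m - N`. The leading coefficient of `χ` becomes `Q(0) =
  -- 1`.
  let Q : Polynomial A := χ.reflect N
  have hQ : ∀ i ≤ N, Q.coeff i = χ.coeff (N - i) := fun i hi => by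
    rw [Polynomial.coeff_reflect, Polynomial.revAt_le hi]
  have hQ' : ∀ i, N < i → Q.coeff i = 0 := fun i hi => by
    rw [Polynomial.coeff_reflect, Polynomial.revAt_eq_self_of_lt hi,
      Polynomial.coeff_eq_zero_of_natDegree_lt hi]
  have hQ0 : Q.coeff 0 = 1 := by rw [hQ 0 (Nat.zero_le _)]; exact hχ
  have hz : ∀ m, N ≤ m → PowerSeries.coeff m (f.series * (Q : PowerSeries A)) = 0 := by
    intro m hm
    rw [mul_comm, PowerSeries.coeff_mul, Finset.Nat.sum_antidiagonal_eq_sum_range_succ_mk,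
      ← Finset.sum_subset (Finset.range_subset_range.2 (Nat.succ_le_succ hm)),
      ← Finset.sum_range_reflect, ← hrec (m - N)]
    · refine Finset.sum_congr rfl fun i hi => ?_
      have hi : i ≤ N := by simpa [Nat.lt_succ_iff] using hi
      rw [Polynomial.coeff_coe, hQ _ (by omega)]
      congr 2 <;> congr 1 <;> omega
    · intro i _ hi
      rw [Polynomial.coeff_coe, hQ' _ (by simpa using hi), zero_mul]
  have hP : f.series * (Q : PowerSeries A) =
      (PowerSeries.trunc N (f.series * (Q : PowerSeries A)) : PowerSeries A) := by
    ext m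
    rw [Polynomial.coeff_coe, PowerSeries.coeff_trunc]
    split_ifs with hm
    · rfl
    · exact hz m (by omega)
  refine ⟨_, Q, ?_, hQ0, hP⟩
  rw [← Polynomial.coeff_coe, ← hP, PowerSeries.coeff_zero_eq_constantCoeff_apply, map_mul,
    f.constantCoeff_series, one_mul, ← PowerSeries.coeff_zero_eq_constantCoeff_apply,
    Polynomial.coeff_coe, hQ0]

/-- The coefficients of a rational series satisfy a linear recurrence of any large order. -/
theorem IsRational.exists_recurrence {A : Type*} [CommRing A] {f : BigWitt A}
    (hf : f.IsRational) : ∃ (Q : Polynomial A) (d₀ : ℕ), Q.coeff 0 = 1 ∧ ∀ d, d₀ ≤ d → ∀ k,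
      ∑ t ∈ Finset.range (d + 1), Q.coeff t * PowerSeries.coeff (k + (d - t)) f.series = 0 := by
  obtain ⟨P, Q, -, hQ, h⟩ := hf
  -- The bound `deg P < d` makes the coefficient of `T^(k+d)` in `P` vanish for all `k ≥ 0`; `deg Q
  -- ≤ d` confines the convolution to `t ≤ d`.
  refine ⟨Q, max (P.natDegree + 1) Q.natDegree, hQ, fun d hd k => ?_⟩
  have hP : P.natDegree + 1 ≤ d := (le_max_left _ _).trans hd
  have hQd : Q.natDegree ≤ d := (le_max_right _ _).trans hd
  have e := congrArg (PowerSeries.coeff (k + d)) h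
  rw [Polynomial.coeff_coe, Polynomial.coeff_eq_zero_of_natDegree_lt (by omega), mul_comm,
    PowerSeries.coeff_mul, Finset.Nat.sum_antidiagonal_eq_sum_range_succ_mk,
    ← Finset.sum_subset (Finset.range_subset_range.2 (show d + 1 ≤ (k + d).succ by omega))] at e
  · rw [← e]
    refine Finset.sum_congr rfl fun t ht => ?_
    rw [Finset.mem_range] at ht
    rw [Polynomial.coeff_coe, show k + d - t = k + (d - t) by omega]
  · intro t _ ht
    rw [Finset.mem_range] at ht
    rw [Polynomial.coeff_coe, Polynomial.coeff_eq_zero_of_natDegree_lt (by omega), zero_mul]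

/-- Over a reduced Noetherian ring `W_J = W_rat`. -/
theorem HankelFinite.isRational_of_isReduced {A : Type*} [CommRing A] [IsNoetherianRing A]
    [IsReduced A] {f : BigWitt A} (hf : f.HankelFinite) : f.IsRational := by
  have h := (hankelFinite_iff f).1 hf
  choose! Q d₀ hQ0 hrec using fun p hp => (h p hp).exists_recurrence
  have hfin : {p : PrimeSpectrum A | p.asIdeal ∈ minimalPrimes A}.Finite :=
    (minimalPrimes.finite_of_isNoetherianRing A).preimage
      (fun p _ q _ hpq => PrimeSpectrum.ext hpq)
  -- A single order `d` serves all minimal primes, because there are finitely many and each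
  -- recurrence may be given any larger order.
  obtain ⟨d, hd⟩ := (hfin.image d₀).bddAbove
  let a : ℕ → A := fun k => PowerSeries.coeff k f.series
  let M : Submodule A (ℕ → A) := Submodule.span A (Set.range fun j => (seqShift A ^ j) a)
  -- The recurrence over each residue field is linear in the sequence and stable under shifts, so it
  -- passes from `a` to all of `M`.
  have hM : ∀ m ∈ M, ∀ p : PrimeSpectrum A, p.asIdeal ∈ minimalPrimes A → ∀ k,
      ∑ t ∈ Finset.range (d + 1),
        (Q p).coeff t * algebraMap A p.asIdeal.ResidueField (m (k + (d - t))) = 0 := by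
    intro m hm p hp
    induction hm using Submodule.span_induction with
    | mem x hx =>
      obtain ⟨j, rfl⟩ := hx
      intro k
      rw [← hrec p hp d (hd ⟨p, hp, rfl⟩) (k + j)]
      refine Finset.sum_congr rfl fun t _ => ?_
      beta_reduce
      rw [seqShift_pow_apply, series_map, PowerSeries.coeff_map,
        show k + (d - t) + j = k + j + (d - t) by omega]
    | zero => simp
    | add x y _ _ hx hy =>
      intro k
      simp only [Pi.add_apply, map_add, mul_add, Finset.sum_add_distrib, hx k, hy k, add_zero]
    | smul c x _ hx =>
      intro k
      rw [← mul_zero (algebraMap A p.asIdeal.ResidueField c), ← hx k, Finset.mul_sum]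
      refine Finset.sum_congr rfl fun t _ => ?_
      rw [Pi.smul_apply, smul_eq_mul, map_mul, mul_left_comm]
  -- As `Q(0) = 1`, the recurrence solves for its newest term, so the first `d` terms determine the
  -- image of `m` in each residue field. An element vanishing at all minimal primes is nilpotent,
  -- hence zero.
  have hinj : ∀ m ∈ M, (∀ k < d, m k = 0) → m = 0 := by
    intro m hm h0
    have hp : ∀ p : PrimeSpectrum A, p.asIdeal ∈ minimalPrimes A → ∀ k,
        algebraMap A p.asIdeal.ResidueField (m k) = 0 := by
      intro p hp k
      induction k using Nat.strong_induction_on with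
      | _ k ih =>
        by_cases hk : k < d
        · rw [h0 k hk, map_zero]
        · have := hM m hm p hp (k - d)
          rw [Finset.sum_range_succ', Finset.sum_eq_zero, zero_add, hQ0 p hp, one_mul, Nat.sub_zero,
            Nat.sub_add_cancel (not_lt.1 hk)] at this
          · exact this
          · intro t ht
            rw [Finset.mem_range] at ht
            rw [ih _ (by omega), mul_zero]
    ext k
    have hk : m k ∈ nilradical A := by
      rw [nilradical, ← Ideal.sInf_minimalPrimes, Submodule.mem_sInf]
      intro (p : Ideal A) hpm
      have : p.IsPrime := hpm.1.1
      exact Ideal.algebraMap_residueField_eq_zero.1 (hp ⟨p, this⟩ hpm k)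
    rwa [nilradical_eq_zero, Submodule.zero_eq_bot, Submodule.mem_bot] at hk
  let r : M →ₗ[A] (Fin d → A) := (LinearMap.funLeft A A Fin.val).comp M.subtype
  have hr : Function.Injective r := by
    rw [injective_iff_map_eq_zero]
    intro m hm
    exact Subtype.ext (hinj m m.2 fun k hk => congrFun hm ⟨k, hk⟩)
  -- A submodule of `A^d` is finite over the Noetherian ring `A`.
  have : Module.Finite A M := Module.Finite.of_injective r hr
  have hs : ∀ m ∈ M, seqShift A m ∈ M := by
    intro m hm
    refine (Submodule.span_le (p := M.comap (seqShift A))).2 ?_ hm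
    rintro _ ⟨j, rfl⟩
    refine Submodule.subset_span ⟨j + 1, ?_⟩
    beta_reduce
    rw [pow_succ']
    rfl
  -- Cayley–Hamilton on the finite shift-stable module `M`; evaluating at `a ∈ M` gives a monic
  -- recurrence with coefficients in `A`.
  obtain ⟨χ, hχ, hχ0⟩ := LinearMap.exists_monic_and_aeval_eq_zero A ((seqShift A).restrict hs)
  refine isRational_of_aeval_seqShift hχ ?_
  have ha : a ∈ M := Submodule.subset_span ⟨0, rfl⟩
  have hcomm : ∀ x : M, (Polynomial.aeval ((seqShift A).restrict hs) χ x : ℕ → A) =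
      Polynomial.aeval (seqShift A) χ (x : ℕ → A) := by
    intro x
    have hpow : ∀ (j : ℕ) (x : M), (((seqShift A).restrict hs ^ j) x : ℕ → A) =
        (seqShift A ^ j) (x : ℕ → A) := by
      intro j
      induction j with
      | zero => intro x; rfl
      | succ j ih => intro x; rw [pow_succ, pow_succ, Module.End.mul_apply, ih]; rfl
    simp only [Polynomial.aeval_eq_sum_range, LinearMap.sum_apply, Submodule.coe_sum,
      LinearMap.smul_apply, Submodule.coe_smul, hpow]
  have := hcomm ⟨a, ha⟩
  rw [hχ0] at this
  exact this.symm

end BigWitt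

/-! ### Splitting rational Witt vectors into Teichmüller elements over finite extensions -/

/-- A monic polynomial splits over a finite extension ring. -/
theorem Polynomial.Monic.exists_finite_injective_map_eq_prod {n : ℕ} :
    ∀ {A : Type u} [CommRing A] {P : Polynomial A}, P.Monic → P.natDegree = n →
      ∃ (B : Type u) (_ : CommRing B) (φ : A →+* B) (s : Multiset B), φ.Finite ∧
        Function.Injective φ ∧ s.card = n ∧ P.map φ = (s.map fun b => X - C b).prod := by
  -- One root is adjoined at a time. The ring stays quantified, since the inductive hypothesis is
  -- applied over `AdjoinRoot P`.
  induction n with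
  | zero =>
    intro A _ P hP hn
    refine ⟨A, inferInstance, RingHom.id A, 0, RingHom.Finite.id A, fun _ _ h => h, rfl, ?_⟩
    rw [hP.natDegree_eq_zero.1 hn]
    simp
  | succ n ih =>
    intro A _ P hP hn
    have : Nontrivial A := by
      refine not_subsingleton_iff_nontrivial.1 fun _ => ?_
      rw [Subsingleton.elim P 0, natDegree_zero] at hn
      omega
    have hfin := hP.finite_adjoinRoot
    have hinj : Function.Injective (AdjoinRoot.of P) := by
      rw [injective_iff_map_eq_zero]
      intro a ha
      by_contra h0
      rw [← AdjoinRoot.mk_C, AdjoinRoot.mk_eq_zero] at ha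
      -- A monic polynomial of positive degree cannot divide a nonzero constant.
      refine hP.not_dvd_of_natDegree_lt (C_ne_zero.2 h0) ?_ ha
      rw [natDegree_C]; omega
    have hnt : Nontrivial (AdjoinRoot P) := hinj.nontrivial
    have hP' := hP.map (AdjoinRoot.of P)
    -- Over `A[X]/(P)` the adjoined root splits off a linear factor; the cofactor is monic of degree
    -- `n`.
    obtain ⟨P', h⟩ := dvd_iff_isRoot.2 (AdjoinRoot.isRoot_root P)
    have hm : P'.Monic := (monic_X_sub_C _).of_mul_monic_left (h ▸ hP')
    have hd : P'.natDegree = n := by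
      have := congrArg natDegree h
      rw [hP.natDegree_map, (monic_X_sub_C _).natDegree_mul hm, natDegree_X_sub_C, hn] at this
      omega
    obtain ⟨B, _, φ, s, hφ, hφi, hs, hsp⟩ := ih hm hd
    refine ⟨B, inferInstance, φ.comp (AdjoinRoot.of P), φ (AdjoinRoot.root P) ::ₘ s,
      hφ.comp ?_, hφi.comp hinj, by simp [hs], ?_⟩
    · exact RingHom.finite_algebraMap.2 hfin
    · rw [← Polynomial.map_map, h, Polynomial.map_mul, hsp]
      simp

/-- Reflection is multiplicative when the reflecting degrees add and bound the degrees of the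
factors; here each factor is reflected in degree one. This turns a splitting into linear factors
into a product of Teichmüller series. -/
theorem Polynomial.reflect_prod_X_sub_C {A : Type*} [CommRing A] (s : Multiset A) :
    ((s.map fun b => X - C b).prod).reflect s.card = (s.map fun b => 1 - C b * X).prod := by
  induction s using Multiset.induction with
  | empty => simp
  | cons b s ih =>
    rw [Multiset.map_cons, Multiset.prod_cons, Multiset.map_cons, Multiset.prod_cons,
      Multiset.card_cons, add_comm, reflect_mul, ih]
    · rw [reflect_sub, reflect_one_X, reflect_C, pow_one]
    · exact natDegree_X_sub_C_le b
    · refine (natDegree_multiset_prod_le _).trans ?_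
      rw [Multiset.map_map]
      refine (Multiset.sum_le_card_nsmul _ 1 ?_).trans (by simp)
      intro x hx
      obtain ⟨y, _, rfl⟩ := Multiset.mem_map.1 hx
      exact natDegree_X_sub_C_le y

namespace BigWitt

/-- The image of `ω` as a subring of the ring of big Witt vectors. -/
noncomputable def teichmullerSpan (A : Type*) [CommRing A] : Subring (BigWitt A) :=
  ((rational A).subtype.comp (ReducedMonoidRing.toRational A)).range

theorem teichmuller_mem_teichmullerSpan {A : Type*} [CommRing A] (a : A) :
    teichmuller a ∈ teichmullerSpan A :=
  ⟨_, ReducedMonoidRing.toRational_single a⟩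

theorem map_mem_teichmullerSpan {A B : Type*} [CommRing A] [CommRing B] (φ : A →+* B)
    {f : BigWitt A} (hf : f ∈ teichmullerSpan A) : map φ f ∈ teichmullerSpan B := by
  obtain ⟨x, rfl⟩ := hf
  exact ⟨ReducedMonoidRing.map φ x,
    congrArg Subtype.val (RingHom.congr_fun (ReducedMonoidRing.toRational_naturality φ) x)⟩

theorem series_multiset_sum {A : Type*} [CommRing A] (s : Multiset (BigWitt A)) :
    s.sum.series = (s.map series).prod := by
  induction s using Multiset.induction with
  | empty => simp [series_zero]
  | cons a s ih => simp [series_add, ih]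

/-- Since `P(0) = 1`, the reversed polynomial is monic and splits over a finite injective extension.
Reversing back expresses `f` there as a product of series `1 - bT`, which is a Witt sum. -/
theorem IsPoly.exists_finite_map_mem {A : Type u} [CommRing A] {f : BigWitt A} (hf : f.IsPoly) :
    ∃ (B : Type u) (_ : CommRing B) (φ : A →+* B), φ.Finite ∧ Function.Injective φ ∧
      map φ f ∈ teichmullerSpan B := by
  obtain ⟨P, hP⟩ := hf
  have hP0 : P.coeff 0 = 1 := by
    rw [← Polynomial.coeff_coe, ← hP, PowerSeries.coeff_zero_eq_constantCoeff_apply,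
      f.constantCoeff_series]
  -- The degree computation below uses `1 ≠ 0`; over the zero ring every Witt vector is zero.
  rcases subsingleton_or_nontrivial A with hA | hA
  · refine ⟨A, inferInstance, RingHom.id A, RingHom.Finite.id A, fun _ _ h => h, ?_⟩
    rw [show map (RingHom.id A) f = 0 from BigWitt.ext (Subsingleton.elim _ _)]
    exact zero_mem _
  let N := P.natDegree
  have hc : (P.reflect N).coeff N = 1 := by
    rw [Polynomial.coeff_reflect, Polynomial.revAt_le le_rfl, Nat.sub_self, hP0]
  have hle : (P.reflect N).natDegree ≤ N := by
    rw [Polynomial.natDegree_le_iff_coeff_eq_zero]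
    intro i hi
    rw [Polynomial.coeff_reflect, Polynomial.revAt_eq_self_of_lt hi,
      Polynomial.coeff_eq_zero_of_natDegree_lt hi]
  have hm := Polynomial.monic_of_natDegree_le_of_coeff_eq_one N hle hc
  have hd : (P.reflect N).natDegree = N :=
    le_antisymm hle (Polynomial.le_natDegree_of_ne_zero (by rw [hc]; exact one_ne_zero))
  obtain ⟨B, _, φ, s, hφ, hφi, hs, hsp⟩ := hm.exists_finite_injective_map_eq_prod hd
  refine ⟨B, inferInstance, φ, hφ, hφi, ?_⟩
  have key : map φ f = (s.map teichmuller).sum := by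
    refine BigWitt.ext ?_
    have h := congrArg (Polynomial.reflect N) hsp
    rw [← Polynomial.reflect_map, Polynomial.reflect_reflect, ← hs,
      Polynomial.reflect_prod_X_sub_C] at h
    have h' := congrArg Polynomial.coeToPowerSeries.ringHom h
    rw [map_multiset_prod, Multiset.map_map] at h'
    rw [series_map, hP, series_multiset_sum, Multiset.map_map]
    simpa [teichmuller, Function.comp_def] using h'
  rw [key]
  refine Subring.multiset_sum_mem _ _ fun x hx => ?_
  obtain ⟨b, _, rfl⟩ := Multiset.mem_map.1 hx
  exact teichmuller_mem_teichmullerSpan b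

/-- A quotient of polynomials is a Witt difference `p - q`. First `p` is split over `B`, then the
image of `q` over a finite extension `C` of `B`; the splitting of `p` survives base change.
Injectivity is kept for surjectivity on spectra. -/
theorem IsRational.exists_finite_map_mem {A : Type u} [CommRing A] {f : BigWitt A}
    (hf : f.IsRational) :
    ∃ (B : Type u) (_ : CommRing B) (φ : A →+* B), φ.Finite ∧ Function.Injective φ ∧
      BigWitt.map φ f ∈ teichmullerSpan B := by
  obtain ⟨p, q, hp, hq, h⟩ := (isRational_iff f).1 hf
  obtain ⟨B, _, φ, hφ, hφi, hφp⟩ := hp.exists_finite_map_mem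
  have hq' : (BigWitt.map φ q).IsPoly := by
    obtain ⟨Q, hQ⟩ := hq
    exact ⟨Q.map φ, by rw [series_map, hQ, Polynomial.polynomial_map_coe]⟩
  obtain ⟨C, _, ψ, hψ, hψi, hψq⟩ := hq'.exists_finite_map_mem
  refine ⟨C, inferInstance, ψ.comp φ, hψ.comp hφ, hψi.comp hφi, ?_⟩
  rw [eq_sub_of_add_eq h, map_sub, BigWitt.map_comp]
  exact sub_mem (map_mem_teichmullerSpan ψ hφp) hψq

end BigWitt

/-! ### Injectivity of `ω` over a domain -/

namespace ReducedMonoidRing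

theorem toRational_mk {A : Type*} [CommRing A] (y : MonoidAlgebra ℤ A) :
    (toRational A (Ideal.Quotient.mk _ y) : BigWitt A) =
      y.coeff.sum fun a n => n • BigWitt.teichmuller a := by
  have : (toRational A (Ideal.Quotient.mk _ y)) = MonoidAlgebra.lift ℤ (BigWitt.rational A) A
      { toFun := fun a => ⟨BigWitt.teichmuller a, (BigWitt.isPoly_teichmuller a).isRational⟩
        map_one' := rfl
        map_mul' := fun a b => Subtype.ext (BigWitt.teichmuller_mul a b) } y := rfl
  rw [this, MonoidAlgebra.lift_apply]
  simp [Finsupp.sum]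

/-- Over a domain the Teichmüller representatives of nonzero elements are linearly independent. -/
theorem eq_zero_of_sum_teichmuller_eq_zero {A : Type*} [CommRing A] [IsDomain A] (y : A →₀ ℤ)
    (h : (y.sum fun a n => n • BigWitt.teichmuller a) = 0) {a : A} (ha : a ≠ 0) : y a ≤ 0 := by
  -- Only one inequality is needed: applied to `-y` as well, it gives `y a = 0`. Separating positive
  -- and negative parts turns the relation into an equality of two products of linear polynomials.
  by_contra! hpos
  have h1 : ∑ b ∈ y.support, (y b).toNat • BigWitt.teichmuller b =
      ∑ b ∈ y.support, (-y b).toNat • BigWitt.teichmuller b := by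
    rw [← sub_eq_zero, ← Finset.sum_sub_distrib, ← h]
    refine Finset.sum_congr rfl fun b _ => ?_
    rw [← natCast_zsmul, ← natCast_zsmul, ← sub_smul, Int.toNat_sub_toNat_neg]
  have hser : ∀ n : A → ℕ, (∑ b ∈ y.support, n b • BigWitt.teichmuller b).series =
      ((∏ b ∈ y.support, (1 - Polynomial.C b * Polynomial.X) ^ n b : Polynomial A) :
        PowerSeries A) := by
    intro n
    have hn : ∀ (k : ℕ) (f : BigWitt A), (k • f).series = f.series ^ k := by
      intro k f
      induction k with
      | zero => rw [zero_smul, pow_zero, BigWitt.series_zero]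
      | succ k ih => rw [succ_nsmul, BigWitt.series_add, ih, pow_succ]
    rw [Finset.sum, BigWitt.series_multiset_sum, Multiset.map_map]
    rw [← Polynomial.coeToPowerSeries.ringHom_apply, map_prod]
    refine congrArg Multiset.prod (Multiset.map_congr rfl fun b _ => ?_)
    rw [Function.comp_apply, hn]
    simp [BigWitt.teichmuller]
  have h2 : (∏ b ∈ y.support, (1 - Polynomial.C b * Polynomial.X) ^ (y b).toNat : Polynomial A) =
      ∏ b ∈ y.support, (1 - Polynomial.C b * Polynomial.X) ^ (-y b).toNat := by
    refine Polynomial.coe_injective A ?_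
    rw [← hser, ← hser, h1]
  let K := FractionRing A
  let i := algebraMap A K
  have hi : Function.Injective i := IsFractionRing.injective A K
  -- At `T = 1/a` the left product vanishes because `y a > 0`. Hence some factor `1 - bT` on the
  -- right vanishes there, forcing `b = a`, while its nonzero exponent forces `y b < 0`.
  have h3 := congrArg (Polynomial.eval₂ i (i a)⁻¹) h2
  have hia : i a ≠ 0 := (map_ne_zero_iff i hi).2 ha
  simp only [Polynomial.eval₂_finsetProd, Polynomial.eval₂_pow, Polynomial.eval₂_sub,
    Polynomial.eval₂_one, Polynomial.eval₂_mul, Polynomial.eval₂_C, Polynomial.eval₂_X] at h3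
  rw [Finset.prod_eq_zero (Finsupp.mem_support_iff.2 hpos.ne') (by
    rw [mul_inv_cancel₀ hia, sub_self, zero_pow (by omega)]), eq_comm, Finset.prod_eq_zero_iff] at h3
  obtain ⟨b, -, hb⟩ := h3
  have hb0 := eq_zero_of_pow_eq_zero hb
  have hb1 : (-y b).toNat ≠ 0 := by
    intro h0
    rw [h0, pow_zero] at hb
    exact one_ne_zero hb
  have : b = a := by
    apply hi
    have := sub_eq_zero.1 hb0
    rwa [eq_comm, mul_inv_eq_one₀ hia] at this
  subst this
  omega

/-- Over a domain `ω` is injective. -/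
theorem toRational_injective {A : Type*} [CommRing A] [IsDomain A] :
    Function.Injective (toRational A) := by
  rw [injective_iff_map_eq_zero]
  intro x hx
  obtain ⟨y, rfl⟩ := Ideal.Quotient.mk_surjective x
  have h := toRational_mk y
  rw [hx] at h
  have h0 : ∀ a ≠ 0, y.coeff a = 0 := by
    intro a ha
    refine le_antisymm (eq_zero_of_sum_teichmuller_eq_zero y.coeff h.symm ha) ?_
    have := eq_zero_of_sum_teichmuller_eq_zero (-y.coeff) (by
      rw [Finsupp.sum_neg_index (by simp)]
      simp only [neg_smul, Finsupp.sum_neg]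
      rw [← h]
      exact neg_zero) ha
    simpa using this
  -- Only a multiple of `(0)` is left, and that is what the reduced monoid ring divides out.
  have hy : y = MonoidAlgebra.single 0 (y.coeff 0) := by
    ext a
    by_cases ha : a = 0
    · subst ha; simp
    · rw [h0 a ha, MonoidAlgebra.coeff_single, Finsupp.single_eq_of_ne ha]
  rw [hy, Ideal.Quotient.eq_zero_iff_mem]
  have : (MonoidAlgebra.single (0 : A) (y.coeff 0) : MonoidAlgebra ℤ A) =
      MonoidAlgebra.single 1 (y.coeff 0) * MonoidAlgebra.single (0 : A) 1 := by
    rw [MonoidAlgebra.single_mul_single, one_mul, mul_one]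
  rw [this]
  exact Ideal.mul_mem_left _ _ (Ideal.subset_span rfl)

end ReducedMonoidRing
-- Morphisms of Noetherian affine schemes from ring homomorphisms
namespace NoethAffSch

open Opposite

/-- The spectrum of a Noetherian ring as a Noetherian affine scheme. -/
noncomputable def spec (B : Type u) [CommRing B] [IsNoetherianRing B] : NoethAffSch.{u} :=
  ⟨Spec (CommRingCat.of B), inferInstance, inferInstance⟩

section SpecHom

variable {X : NoethAffSch.{u}} {B : Type u} [CommRing B] [IsNoetherianRing B]

/-- The morphism `Spec B ⟶ X` given by a ring homomorphism `Γ(X, 𝒪_X) → B`. -/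
noncomputable def specHom (φ : structurePresheaf.obj (op X) →+* B) : spec B ⟶ X :=
  have : IsAffine X.obj := X.property.1
  let ψ : Γ(X.obj, ⊤) ⟶ CommRingCat.of B := CommRingCat.ofHom φ
  ObjectProperty.homMk (Spec.map ψ ≫ X.obj.isoSpec.inv)

variable (B) in
/-- The canonical map from `B` to the ring of global sections of `Spec B`. -/
noncomputable def specSections : B →+* structurePresheaf.obj (op (spec B)) :=
  (Scheme.ΓSpecIso (CommRingCat.of B)).inv.hom

/-- By naturality of `Γ(Spec B) ≅ B`. The factorization lets restriction along `specHom φ` be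
computed by first applying `φ`, so algebraic facts over `B` transfer to sections. -/
theorem structurePresheaf_map_specHom (φ : structurePresheaf.obj (op X) →+* B) :
    (structurePresheaf.map (specHom φ).op).hom = (specSections B).comp φ := by
  have : IsAffine X.obj := X.property.1
  have h1 : X.obj.isoSpec.inv.appTop = (Scheme.ΓSpecIso Γ(X.obj, ⊤)).inv := by
    have h2 := congrArg Scheme.Hom.appTop X.obj.isoSpec.hom_inv_id
    rw [Scheme.Hom.comp_appTop, Scheme.isoSpec_hom, Scheme.toSpecΓ_appTop] at h2
    rw [← cancel_mono (Scheme.ΓSpecIso Γ(X.obj, ⊤)).hom, Iso.inv_hom_id]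
    exact h2
  let ψ : Γ(X.obj, ⊤) ⟶ CommRingCat.of B := CommRingCat.ofHom φ
  refine congrArg CommRingCat.Hom.hom (?_ : (Spec.map ψ ≫ X.obj.isoSpec.inv).appTop =
    ψ ≫ (Scheme.ΓSpecIso (CommRingCat.of B)).inv)
  rw [Scheme.Hom.comp_appTop, h1]
  exact (Scheme.ΓSpecIso_inv_naturality _).symm

theorem isClosedImmersion_specHom {φ : structurePresheaf.obj (op X) →+* B}
    (hφ : Function.Surjective φ) : IsClosedImmersion (specHom φ).hom := by
  have : IsAffine X.obj := X.property.1
  let ψ : Γ(X.obj, ⊤) ⟶ CommRingCat.of B := CommRingCat.ofHom φ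
  have := IsClosedImmersion.spec_of_surjective ψ hφ
  exact inferInstanceAs (IsClosedImmersion (Spec.map ψ ≫ X.obj.isoSpec.inv))

theorem isFinite_specHom {φ : structurePresheaf.obj (op X) →+* B} (hφ : φ.Finite) :
    IsFinite (specHom φ).hom := by
  have : IsAffine X.obj := X.property.1
  let ψ : Γ(X.obj, ⊤) ⟶ CommRingCat.of B := CommRingCat.ofHom φ
  have := (IsFinite.SpecMap_iff ψ).2 hφ
  exact inferInstanceAs (IsFinite (Spec.map ψ ≫ X.obj.isoSpec.inv))

end SpecHom

theorem jointlySurjective_specHom {X : NoethAffSch.{u}} {ι : Type w} {B : ι → Type u}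
    [∀ i, CommRing (B i)] [∀ i, IsNoetherianRing (B i)]
    (φ : ∀ i, structurePresheaf.obj (op X) →+* B i)
    (h : ∀ p : PrimeSpectrum (structurePresheaf.obj (op X)),
      ∃ i, p ∈ Set.range (PrimeSpectrum.comap (φ i))) :
    JointlySurjective fun i => specHom (φ i) := by
  have : IsAffine X.obj := X.property.1
  intro x
  obtain ⟨i, q, hq⟩ := h (X.obj.isoSpec.hom x)
  refine ⟨i, q, ?_⟩
  have h1 : X.obj.isoSpec.inv (X.obj.isoSpec.hom x) = x := by
    rw [← Scheme.Hom.comp_apply, Iso.hom_inv_id]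
    rfl
  rw [← h1, ← hq]
  rfl

/-! ### Local injectivity and local surjectivity -/

section Topology

variable (J : GrothendieckTopology NoethAffSch.{u})

/-- A morphism of presheaves which is bijective up to refinement along covering families becomes an
isomorphism after sheafification. -/
theorem isIso_sharp_map {F G : NoethAffSch.{u}ᵒᵖ ⥤ CommRingCat.{u}} (α : F ⟶ G)
    (hi : ∀ (X : NoethAffSch.{u}) (x y : F.obj (op X)), α.app (op X) x = α.app (op X) y →
      ∃ (ι : Type w) (Y : ι → NoethAffSch.{u}) (f : ∀ i, Y i ⟶ X), Sieve.ofArrows Y f ∈ J X ∧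
        ∀ i, F.map (f i).op x = F.map (f i).op y)
    (hs : ∀ (X : NoethAffSch.{u}) (s : G.obj (op X)),
      ∃ (ι : Type w) (Y : ι → NoethAffSch.{u}) (f : ∀ i, Y i ⟶ X), Sieve.ofArrows Y f ∈ J X ∧
        ∀ i, ∃ t, α.app (op (Y i)) t = G.map (f i).op s) :
    IsIso ((sharp J).map α) := by
  have h1 : Presheaf.IsLocallyInjective J (Functor.whiskerRight α ringULift) := by
    refine ⟨fun {X} x y h => ?_⟩
    obtain ⟨ι, Y, f, hf, hxy⟩ := hi X.unop x.down y.down (congrArg ULift.down h)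
    refine J.superset_covering ?_ hf
    -- The sieve on which `x` and `y` agree contains the covering family, hence the sieve it
    -- generates.
    rw [Sieve.ofArrows, Sieve.generate_le_iff]
    rintro _ _ ⟨i⟩
    exact congrArg ULift.up (hxy i)
  have h2 : Presheaf.IsLocallySurjective J (Functor.whiskerRight α ringULift) := by
    refine ⟨fun {X} s => ?_⟩
    obtain ⟨ι, Y, f, hf, hst⟩ := hs X s.down
    refine J.superset_covering ?_ hf
    rw [Sieve.ofArrows, Sieve.generate_le_iff]
    rintro _ _ ⟨i⟩
    obtain ⟨t, ht⟩ := hst i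
    exact ⟨ULift.up t, congrArg ULift.up ht⟩
  exact (GrothendieckTopology.W_iff _ _).1
    (J.W_of_isLocallyBijective (Functor.whiskerRight α ringULift))

/-- Sheafification preserves local injectivity, and a locally injective morphism of sheaves is
injective on sections. -/
theorem injective_sharp_map {F G : NoethAffSch.{u}ᵒᵖ ⥤ CommRingCat.{u}} (α : F ⟶ G)
    (hi : ∀ X, Function.Injective (α.app X)) (X : NoethAffSch.{u}ᵒᵖ) :
    Function.Injective (((sharp J).map α).hom.app X) := by
  have h1 : Presheaf.IsLocallyInjective J (Functor.whiskerRight α ringULift) :=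
    Presheaf.isLocallyInjective_of_injective J _ fun X x y h =>
      ULift.down_injective (hi X (congrArg ULift.down h))
  exact (Sheaf.isLocallyInjective_iff_injective _).1
    ((Presheaf.isLocallyInjective_presheafToSheaf_map_iff J _).2 h1) X

/-- The hypothesis isolates what both parts of the theorem supply: a surjective closed immersion is
a covering. It is used for the identity and for the reduced subscheme, over which every section of
`W_J` is rational. -/
theorem isIso_sharp_map_rationalToHankel
    (hJ : ∀ (X : NoethAffSch.{u}) (B : Type u) [CommRing B] [IsNoetherianRing B]
      (φ : structurePresheaf.obj (op X) →+* B), Function.Surjective φ →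
        Function.Surjective (PrimeSpectrum.comap φ) →
          Sieve.ofArrows (fun _ : PUnit.{w + 1} => spec B) (fun _ => specHom φ) ∈ J X) :
    IsIso ((sharp J).map rationalToHankel) := by
  refine isIso_sharp_map.{u, w} J _ (fun X x y h => ?_) (fun X s => ?_)
  · exact ⟨PUnit, _, fun _ => specHom (RingHom.id _),
      hJ X _ (RingHom.id _) Function.surjective_id fun p => ⟨p, rfl⟩,
      fun _ => congrArg _ (Subtype.ext (congrArg (fun z => z.1) h))⟩
  · let A := structurePresheaf.obj (op X)
    let π := Ideal.Quotient.mk (nilradical A)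
    have : _root_.IsReduced (A ⧸ nilradical A) :=
      (Ideal.isRadical_iff_quotient_reduced _).1 (Ideal.radical_isRadical _)
    have hπ : Function.Surjective π := Ideal.Quotient.mk_surjective
    refine ⟨PUnit, _, fun _ => specHom π, hJ X _ π hπ ?_, fun _ => ?_⟩
    -- Every prime contains the nilradical, so the reduced subscheme has the same points.
    · rw [← Set.range_eq_univ, range_comap_of_surjective _ _ hπ, Ideal.mk_ker,
        nilradical, PrimeSpectrum.zeroLocus_radical, Ideal.zero_eq_bot,
        PrimeSpectrum.zeroLocus_bot]
    · have h1 : (BigWitt.map π s.1).IsRational :=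
        BigWitt.HankelFinite.isRational_of_isReduced
          (s.2.imp fun _ hn => hn.map π)
      have h2 : (hankelPresheaf.map (specHom π).op s).1 =
          BigWitt.map (specSections (A ⧸ nilradical A))
            (BigWitt.map π s.1) := by
        change BigWitt.map (structurePresheaf.map (specHom π).op).hom s.1 = _
        rw [structurePresheaf_map_specHom, BigWitt.map_comp]
        rfl
      exact ⟨⟨_, h1.map _⟩, Subtype.ext h2.symm⟩

/-- Injectivity is checked on the irreducible components, surjectivity on a finite cover over which
the given rational Witt vector splits. -/
theorem isIso_sharp_map_monoidRingToRational
    (hJ : finitePretopology.{u, w}.toGrothendieck ≤ J) :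
    IsIso ((sharp J).map monoidRingToRational) := by
  refine isIso_sharp_map.{u, w} J _ (fun X x y h => ?_) (fun X s => ?_)
  · let A := structurePresheaf.obj (op X)
    have hfin := minimalPrimes.finite_of_isNoetherianRing A
    obtain ⟨n, ⟨e⟩⟩ := hfin.to_subtype.exists_equiv_fin
    -- Finiteness of the set of minimal primes allows the family to be indexed in the universe `w`
    -- of the coverings.
    let q : ULift.{w} (Fin n) → Ideal A := fun i => (e.symm i.down).1
    have hq : ∀ i, (q i).IsPrime := fun i => (e.symm i.down).2.1.1
    let π : ∀ i, A →+* A ⧸ q i := fun i => Ideal.Quotient.mk (q i)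
    refine ⟨ULift.{w} (Fin n), _, fun i => specHom (π i), hJ X ⟨_, _, _, ⟨fun i =>
      isFinite_specHom (RingHom.Finite.of_surjective _ Ideal.Quotient.mk_surjective),
      jointlySurjective_specHom π fun p => ?_⟩, fun i => Sieve.ofArrows_mk _ _ i⟩, fun i => ?_⟩
    · obtain ⟨p', hp', hle⟩ := Ideal.exists_minimalPrimes_le (bot_le (a := p.asIdeal))
      refine ⟨⟨e ⟨p', hp'⟩⟩, ?_⟩
      rw [range_comap_of_surjective _ _ Ideal.Quotient.mk_surjective, Ideal.mk_ker]
      simpa [q, PrimeSpectrum.mem_zeroLocus] using hle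
    -- By naturality the images of `x` and `y` have the same `ω`, and `ω` is injective over the
    -- domain `A/q`.
    · have h1 : ReducedMonoidRing.map (π i) x = ReducedMonoidRing.map (π i) y := by
        apply ReducedMonoidRing.toRational_injective
        have h2 := ReducedMonoidRing.toRational_naturality (π i)
        have h3 := RingHom.congr_fun h2 x
        have h4 := RingHom.congr_fun h2 y
        exact h3.trans ((congrArg (BigWitt.rationalMap (π i)) h).trans h4.symm)
      change ReducedMonoidRing.map (structurePresheaf.map (specHom (π i)).op).hom x =
        ReducedMonoidRing.map (structurePresheaf.map (specHom (π i)).op).hom y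
      rw [structurePresheaf_map_specHom, ReducedMonoidRing.map_comp]
      exact congrArg (ReducedMonoidRing.map (specSections (A ⧸ q i))) h1
  · let A := structurePresheaf.obj (op X)
    obtain ⟨B, _, φ, hφ, hφi, y, hy⟩ := BigWitt.IsRational.exists_finite_map_mem (A := A) s.2
    -- Needed for `Spec B` to be an object of the site.
    have hB : IsNoetherianRing B := by
      algebraize [φ]
      exact IsNoetherianRing.of_finite A B
    refine ⟨PUnit, _, fun _ => specHom φ, hJ X ⟨_, _, _, ⟨fun _ => isFinite_specHom hφ,
      jointlySurjective_specHom (fun _ => φ) fun p =>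
        -- Lying over for the injective integral map `φ`.
        ⟨⟨⟩, hφ.to_isIntegral.comap_surjective hφi p⟩⟩, fun i => Sieve.ofArrows_mk _ _ i⟩,
      fun _ => ⟨ReducedMonoidRing.map (specSections B) y,
        Subtype.ext ?_⟩⟩
    change _ = BigWitt.map (structurePresheaf.map (specHom φ).op).hom s.1
    rw [structurePresheaf_map_specHom, BigWitt.map_comp]
    refine (congrArg Subtype.val (RingHom.congr_fun
      (ReducedMonoidRing.toRational_naturality (specSections B))
        y)).trans ?_
    exact congrArg (BigWitt.map (specSections B)) hy

end Topology

end NoethAffSch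

/-! ### The comparison theorem -/

theorem propositiont4p8 (τ : FamilyPretopology.{u + 1, u, w} NoethAffSch.{u}) :
    ((∀ (X : NoethAffSch.{u}) (ι : Type w) [Finite ι] (Y : ι → NoethAffSch.{u})
        (f : ∀ i, Y i ⟶ X), (∀ i, IsClosedImmersion (f i).hom) →
          NoethAffSch.JointlySurjective f → τ.Cov X Y f) →
      IsIso ((NoethAffSch.sharp τ.toGrothendieck).map NoethAffSch.rationalToHankel)) ∧
    (NoethAffSch.finitePretopology.{u, w}.toGrothendieck ≤ τ.toGrothendieck →
      IsIso ((NoethAffSch.sharp τ.toGrothendieck).map NoethAffSch.monoidRingToRational) ∧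
      IsIso ((NoethAffSch.sharp τ.toGrothendieck).map NoethAffSch.rationalToHankel) ∧
      ∀ X : NoethAffSch.{u}ᵒᵖ,
        Function.Injective (((NoethAffSch.sharp τ.toGrothendieck).map
          (NoethAffSch.monoidRingToRational ≫ NoethAffSch.rationalToHankel ≫
            NoethAffSch.hankelToWitt)).hom.app X) ∧
        Function.Injective (((NoethAffSch.sharp τ.toGrothendieck).map
          (NoethAffSch.rationalToHankel ≫ NoethAffSch.hankelToWitt)).hom.app X) ∧
        Function.Injective (((NoethAffSch.sharp τ.toGrothendieck).map
          NoethAffSch.hankelToWitt).hom.app X)) := by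
  have hinj := NoethAffSch.injective_sharp_map τ.toGrothendieck NoethAffSch.hankelToWitt
    fun _ _ _ h => Subtype.ext h
  refine ⟨fun hτ => NoethAffSch.isIso_sharp_map_rationalToHankel.{u, w} _
    fun X B _ _ φ hφ hφ' => ?_, fun hτ => ?_⟩
  · exact ⟨_, _, _, hτ X PUnit _ _ (fun _ => NoethAffSch.isClosedImmersion_specHom hφ)
      (NoethAffSch.jointlySurjective_specHom (fun _ => φ) fun p => ⟨⟨⟩, hφ' p⟩),
      fun i => Sieve.ofArrows_mk _ _ i⟩
  · have h1 := NoethAffSch.isIso_sharp_map_monoidRingToRational τ.toGrothendieck hτ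
    have h2 := NoethAffSch.isIso_sharp_map_rationalToHankel.{u, w} τ.toGrothendieck
      -- A surjective ring homomorphism is finite, so surjective closed immersions are
      -- `f`-coverings.
      fun X B _ _ φ hφ hφ' => hτ X ⟨_, _, _, ⟨fun _ => NoethAffSch.isFinite_specHom
        (RingHom.Finite.of_surjective _ hφ),
        NoethAffSch.jointlySurjective_specHom (fun _ => φ) fun p => ⟨⟨⟩, hφ' p⟩⟩,
        fun i => Sieve.ofArrows_mk _ _ i⟩
    have hbij : ∀ {F G : Sheaf τ.toGrothendieck CommRingCat.{u + 1}} (α : F ⟶ G) [IsIso α]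
        (X : NoethAffSch.{u}ᵒᵖ), Function.Injective (α.hom.app X) := fun α _ =>
      (Sheaf.isLocallyInjective_iff_injective α).1 inferInstance
    have h3 : ∀ X, Function.Injective (((NoethAffSch.sharp τ.toGrothendieck).map
        (NoethAffSch.rationalToHankel ≫ NoethAffSch.hankelToWitt)).hom.app X) :=
      NoethAffSch.injective_sharp_map _ _ fun _ _ _ h => Subtype.ext h
    refine ⟨h1, h2, fun X => ⟨?_, h3 X, hinj X⟩⟩
    -- On presheaves `ω` need not be injective: if `ε² = 0`, then `(ε) + (-ε)` maps to `(1 - εT)(1 +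
    -- εT) = 1`, the zero of `W`. Hence the composite is split after sheafification, where `ω` is an
    -- isomorphism.
    rw [Functor.map_comp]
    exact (h3 X).comp (hbij ((NoethAffSch.sharp τ.toGrothendieck).map
      NoethAffSch.monoidRingToRational) X)
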